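/- Let $\mathbb T=\mathbb R/\mathbb Z$ with arc-length metric $d$, let $T:\mathbb T\to\mathbb T$ be a $C^2$ circle endomorphism of degree two with $a_1<DT(x)<a_2$ for all $x$, for some constants $0<a_1<a_2$, and let $\vartheta>0$. Put $T_a(x)=T(x+a \bmod 1)$. Let $\omega=(\omega_i)_{i\ge 0}$ be an i.i.d. sequence of uniformly distributed variables on $[-\vartheta,\vartheta]$, with law $\mathbb P$ and expectation $\mathbb E$, and write $T^n_\omega=T_{\omega_{n-1}}\circ\cdots\circ T_{\omega_0}$. Assume that (i) there is $k>0$ such that for all $x,y\in\mathbb T$ there is $\omega\in[-\vartheta,\vartheta]^{\mathbb N}$ with $T^k_\omega(x)=y$; (ii) $T$ has a hyperbolic attracting periodic orbit. Let $\mu$ be a stationary probability measure on $\mathbb T$, i.e. $\mathbb E[\mu(T_{\omega_0}^{-1}A)]=\mu(A)$ for all Borel sets $A$, and assume that the Lyapunov exponent vanishes: $$\lambda=\int_{\mathbb T}\mathbb E\left[\ln DT_{\omega_0}(x)\right]d\mu(x)=0 .$$ Then for every $q\in\mathbb R$ the limit $$\Lambda(q)=\lim_{n\to\infty}\frac1n\ln\mathbb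 E\left[\left(DT^n_\omega(x)\right)^q\right]$$ exists and is independent of $x\in\mathbb T$, the function $\Lambda$ is $C^2$ near $0$, and $V:=\Lambda''(0)>0$. For $x,y\in\mathbb T$ let $$\tau_{\delta,+}(x,y)=\min\{n\ge0 : d(T^n_\omega(x),T^n_\omega(y))>\delta\},\qquad \tau_{\varepsilon,-}(x,y)=\min\{n\ge0 : d(T^n_\omega(x),T^n_\omega(y))<\varepsilon\},$$ with $\min\emptyset=\infty$. There exist $R>0$ and $K>0$ such that for all $x,y\in\mathbb T$ and all $\varepsilon,\delta$ with $0<\varepsilon<d(x,y)<\delta<R$, $$\mathbb P\left(\min\{\tau_{\varepsilon,-}(x,y),\tau_{\delta,+}(x,y)\}<\infty\right)=1,$$ $$\frac{\ln\left(\frac{\delta}{d(x,y)}\right)-2K}{\ln\left(\frac{\delta}{\varepsilon}\right)}\le\mathbb P\left(\tau_{\varepsilon,-}(x,y)<\tau_{\delta,+}(x,y)\right)\le\frac{\ln\left(\frac{\delta}{d(x,y)}\right)+2K}{\ln\left(\frac{\delta}{\varepsilon}\right)},$$ and $\mathbb E[\min\{\tau_{\varepsilon,-}(x,y),\tau_{\delta,+}(x,y)\}]$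 is finite with $$\frac1V\left(\ln\tfrac{\delta}{d(x,y)}\,\ln\tfrac{d(x,y)}{\varepsilon}-6K|\ln\varepsilon|-2K^2\right)\le\mathbb E\left[\min\{\tau_{\varepsilon,-}(x,y),\tau_{\delta,+}(x,y)\}\right]\le\frac1V\left(\ln\tfrac{\delta}{d(x,y)}\,\ln\tfrac{d(x,y)}{\varepsilon}+6K|\ln\varepsilon|+2K^2\right).$$ -/

import Mathlib

open MeasureTheory Filter Topology

noncomputable section

/-- The data of a random circle endomorphism on the circle `ℝ / ℤ` (`UnitAddCircle`, whose `dist`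
is the arc-length metric): an orientation preserving `C²` circle endomorphism `T` of degree two,
given by a lift `F` to the real line, with derivative bounded and bounded away from zero, together
with a noise amplitude `ϑ > 0`. -/
structure RandomCircleMap where
  /-- lift of the circle map to the real line -/
  F : ℝ → ℝ
  contDiff_F : ContDiff ℝ 2 F
  /-- the circle map has degree two -/
  F_add_one : ∀ x, F (x + 1) = F x + 2
  deriv_bounds : ∃ a₁ a₂ : ℝ, 0 < a₁ ∧ a₁ < a₂ ∧ ∀ x, a₁ < deriv F x ∧ deriv F x < a₂
  /-- noise amplitude -/
  ϑ : ℝ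
  ϑ_pos : 0 < ϑ

namespace RandomCircleMap

variable (E : RandomCircleMap)

theorem periodic_coe_F : Function.Periodic (fun x : ℝ => (E.F x : UnitAddCircle)) 1 := by
  intro x
  have h : ((1 : ℝ) : UnitAddCircle) = 0 := AddCircle.coe_period 1
  have h2 : ((2 : ℝ) : UnitAddCircle) = 0 := by
    rw [show (2 : ℝ) = 1 + 1 by norm_num, AddCircle.coe_add, h, add_zero]
  simp only [E.F_add_one, AddCircle.coe_add, h2, add_zero]

theorem periodic_deriv_F : Function.Periodic (deriv E.F) 1 := by
  intro x
  have h : (fun y => E.F (y + 1)) = fun y => E.F y + 2 := funext E.F_add_one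
  rw [← deriv_comp_add_const, h, deriv_add_const]

/-- The circle map `T`, that is `x mod 1 ↦ F x mod 1`. -/
def T : UnitAddCircle → UnitAddCircle := E.periodic_coe_F.lift

/-- The derivative `DT` of the circle map, as a function on the circle. -/
def DT : UnitAddCircle → ℝ := E.periodic_deriv_F.lift

/-- The translated map `T_a (x) = T (x + a)`. -/
def Tt (a : ℝ) (x : UnitAddCircle) : UnitAddCircle := E.T (x + (a : UnitAddCircle))

/-- The derivative `DT_a (x) = DT (x + a)`. -/
def DTt (a : ℝ) (x : UnitAddCircle) : ℝ := E.DT (x + (a : UnitAddCircle))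

/-- Random iterates `T^n_ω = T_{ω (n-1)} ∘ ⋯ ∘ T_{ω 0}`. -/
def iter (ω : ℕ → ℝ) : ℕ → UnitAddCircle → UnitAddCircle
  | 0, x => x
  | n + 1, x => E.Tt (ω n) (iter ω n x)

/-- The derivative `DT^n_ω (x)` of the random iterates, by the chain rule
(see `hasDerivAt_iterLift`). -/
def iterDeriv (ω : ℕ → ℝ) (n : ℕ) (x : UnitAddCircle) : ℝ :=
  ∏ i ∈ Finset.range n, E.DTt (ω i) (E.iter ω i x)

/-- The random iterates on the level of lifts. -/
def iterLift (ω : ℕ → ℝ) : ℕ → ℝ → ℝ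
  | 0, x => x
  | n + 1, x => E.F (iterLift ω n x + ω n)

theorem coe_iterLift (ω : ℕ → ℝ) (n : ℕ) (x : ℝ) :
    (E.iterLift ω n x : UnitAddCircle) = E.iter ω n x := by
  induction n with
  | zero => rfl
  | succ n ih =>
    rw [iter, ← ih, Tt, ← AddCircle.coe_add]
    rfl

/-- `iterDeriv` is the derivative of the lift of the random iterate. -/
theorem hasDerivAt_iterLift (ω : ℕ → ℝ) (n : ℕ) (x : ℝ) :
    HasDerivAt (E.iterLift ω n) (E.iterDeriv ω n x) x := by
  induction n with
  | zero =>
    have h : E.iterDeriv ω 0 (x : UnitAddCircle) = 1 := Finset.prod_range_zero _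
    rw [h]
    exact hasDerivAt_id x
  | succ n ih =>
    have h1 : HasDerivAt E.F (deriv E.F (E.iterLift ω n x + ω n)) (E.iterLift ω n x + ω n) :=
      ((E.contDiff_F.differentiable (by norm_num)) _).hasDerivAt
    have h2 := h1.comp x (ih.add_const (ω n))
    have h3 : deriv E.F (E.iterLift ω n x + ω n) = E.DTt (ω n) (E.iter ω n x) := by
      rw [← coe_iterLift, DTt, ← AddCircle.coe_add]
      rfl
    rw [iterDeriv, Finset.prod_range_succ, mul_comm, ← h3]
    exact h2

/-- The law of one noise variable: the uniform distribution on `[-ϑ, ϑ]`. -/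
def noise : Measure ℝ := ProbabilityTheory.cond volume (Set.Icc (-E.ϑ) E.ϑ)

instance : IsProbabilityMeasure E.noise := by
  have h := E.ϑ_pos
  refine ProbabilityTheory.cond_isProbabilityMeasure_of_finite ?_ ?_
  · rw [Real.volume_Icc]
    simpa using h
  · rw [Real.volume_Icc]
    exact ENNReal.ofReal_ne_top

/-- The law `ℙ` of the i.i.d. noise sequence `ω = (ω i)`. -/
def ℙ : Measure (ℕ → ℝ) := Measure.infinitePi fun _ : ℕ => E.noise

/-- There is `k > 0` such that every point can be steered to every point in exactly `k` steps by
noise in `[-ϑ, ϑ]`. -/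
def Minorising : Prop :=
  ∃ k : ℕ, 0 < k ∧ ∀ x y : UnitAddCircle,
    ∃ ω : ℕ → ℝ, (∀ i, ω i ∈ Set.Icc (-E.ϑ) E.ϑ) ∧ E.iter ω k x = y

/-- The map `T` (no noise) has a hyperbolic attracting periodic orbit. -/
def HasAttractingPeriodicOrbit : Prop :=
  ∃ (p : ℕ) (x : UnitAddCircle), 0 < p ∧ E.T^[p] x = x ∧
    |∏ i ∈ Finset.range p, E.DT (E.T^[i] x)| < 1

/-- Stationary measures of the one-point motion. -/
def IsStationary (μ : Measure UnitAddCircle) : Prop :=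
  ∀ A : Set UnitAddCircle, MeasurableSet A → ∫⁻ a, μ (E.Tt a ⁻¹' A) ∂E.noise = μ A

/-- The Lyapunov exponent `λ = ∫ 𝔼 [ln DT_ω (x)] dμ(x)` with respect to a measure `μ`. -/
def lyapunov (μ : Measure UnitAddCircle) : ℝ :=
  ∫ x, ∫ a, Real.log (E.DTt a x) ∂E.noise ∂μ

/-- `(1/n) ln 𝔼 [(DT^n_ω (x))^q]`. -/
def momentRate (q : ℝ) (x : UnitAddCircle) (n : ℕ) : ℝ :=
  1 / (n : ℝ) * Real.log (∫ ω, E.iterDeriv ω n x ^ q ∂E.ℙ)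

/-- The moment Lyapunov function `Λ(q) = lim_n (1/n) ln 𝔼 [(DT^n_ω (x))^q]`, evaluated at the base
point `x = 0`. -/
def momentLyapunov (q : ℝ) : ℝ := limUnder atTop (E.momentRate q 0)

/-- `V = Λ''(0)`. -/
def V : ℝ := deriv (deriv E.momentLyapunov) 0

/-- `τ_{δ,+}(x,y)`: the first time at which the two-point distance exceeds `δ` (`⊤` if never). -/
def exitAbove (δ : ℝ) (x y : UnitAddCircle) (ω : ℕ → ℝ) : ℕ∞ :=
  ⨅ (n : ℕ) (_ : δ < dist (E.iter ω n x) (E.iter ω n y)), (n : ℕ∞)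

/-- `τ_{ε,-}(x,y)`: the first time at which the two-point distance is below `ε` (`⊤` if never). -/
def exitBelow (ε : ℝ) (x y : UnitAddCircle) (ω : ℕ → ℝ) : ℕ∞ :=
  ⨅ (n : ℕ) (_ : dist (E.iter ω n x) (E.iter ω n y) < ε), (n : ℕ∞)

/-- `min {τ_{ε,-}(x,y), τ_{δ,+}(x,y)}`. -/
def exitTime (ε δ : ℝ) (x y : UnitAddCircle) (ω : ℕ → ℝ) : ℕ∞ :=
  min (E.exitBelow ε x y ω) (E.exitAbove δ x y ω)

/-- `𝔼 [min {τ_{ε,-}(x,y), τ_{δ,+}(x,y)}]` as an extended nonnegative number. -/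
def meanExitTime (ε δ : ℝ) (x y : UnitAddCircle) : ENNReal :=
  ∫⁻ ω, (E.exitTime ε δ x y ω : ENNReal) ∂E.ℙ

end RandomCircleMap

end

/-!
The base process `x ↦ T (x + ω₀)` is studied through the tilted transfer operators
`P_q f (x) = 𝔼 [(DT_ω (x))^q f (T_ω x)]` on the Banach space of continuous functions on the circle;
the moments of `DT^n_ω (x)` are the values `P_q ^ n 1 (x)` (`integral_iterDeriv_rpow`).

*Moment Lyapunov function.* Averaging over a noise window of length `2ϑ` keeps half of any value on a
whole interval, and by the steering hypothesis this interval is reached from everywhere; compactness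
then gives a Harnack inequality `P_q ^ (k + 1) f (x) ≥ c P_q f (y)` for `f ≥ 0` (`harnack`). So
`P_q ^ n 1 (x)` is comparable to its supremum, which is submultiplicative, and Fekete's lemma gives
`Λ(q)` (`tendsto_momentRate`). At `q = 0` the Harnack inequality yields a spectral gap: `1 - P + Π` is
invertible, `Π` being the projection `f ↦ μ(f)` (`IsStationary.isUnit_one_sub`). As `q ↦ P_q` is smooth
in operator norm, the implicit function theorem provides positive eigenfunctions `φ_q` depending
smoothly on `q`, with eigenvalue `exp Λ(q)`. Differentiating the eigenvalue equation twice at `0` shows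
that `ψ = ∂_q φ_q` at `q = 0` solves the Poisson equation `ψ - P ψ = 𝔼 ln DT_ω`, that `Λ'(0) = λ = 0`, and
that `Λ''(0)` is the mean of the square of `ln DT_ω(x) + ψ (T_ω x) - ψ x`
(`IsStationary.momentLyapunov_expansion`). If this vanished, `ln DT` would be a coboundary and no
periodic orbit could be attracting (`IsStationary.mean_incrementVar_pos`).

*Two-point motion.* Near the diagonal the logarithmic distance `s` changes in one step by `ln DT` up to
an error proportional to the distance `d`. Thus `N = s + ψ` and `N ^ 2 + χ - n V`, where `χ` solves a
second Poisson equation, are martingales up to errors of order `d` and `(1 + |N|) d`. Since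
`Λ(q) > 0` for small `q > 0`, the bounded function `w = const * d ^ q φ_q` increases on average by at
least `d` in each step, so that adding multiples of `w` turns the approximate martingales into true
sub- and supermartingales at the cost of bounded corrections (`IsStationary.nonempty_corrector`).
Optional stopping, in the form of first-step inductions (`measureReal_hitEvent_le`, `sum_stayEvent_le`,
`le_sum_stayEvent`), applied to `N ± w` and to `(ln δ - N) (N - ln ε) - χ ± |ln ε| w` gives the bounds
for the exit probabilities and for the mean exit time.
-/

noncomputable section

namespace RandomCircleMap

variable (E : RandomCircleMap)

/-! ### The circle map and its logarithmic derivative as continuous functions -/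

theorem T_coe (x : ℝ) : E.T (x : UnitAddCircle) = (E.F x : UnitAddCircle) := rfl

theorem DT_coe (x : ℝ) : E.DT (x : UnitAddCircle) = deriv E.F x := rfl

theorem continuous_T : Continuous E.T := by
  refine continuous_quot_lift _ ?_
  exact (AddCircle.continuous_mk' 1).comp E.contDiff_F.continuous

theorem continuous_DT : Continuous E.DT := by
  refine continuous_quot_lift _ ?_
  exact E.contDiff_F.continuous_deriv (by norm_num)

theorem exists_DT_bounds : ∃ a₁ a₂ : ℝ, 0 < a₁ ∧ a₁ < a₂ ∧ ∀ x, a₁ < E.DT x ∧ E.DT x < a₂ := by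
  obtain ⟨a₁, a₂, h1, h2, h⟩ := E.deriv_bounds
  refine ⟨a₁, a₂, h1, h2, fun x => ?_⟩
  induction x using QuotientAddGroup.induction_on with
  | H x => exact h x

theorem DT_pos (x : UnitAddCircle) : 0 < E.DT x := by
  obtain ⟨a₁, a₂, h1, -, h⟩ := E.exists_DT_bounds
  exact h1.trans (h x).1

/-- The circle map as a bundled continuous map. -/
def TC : C(UnitAddCircle, UnitAddCircle) := ⟨E.T, E.continuous_T⟩

/-- The function `ln DT` on the circle. -/
def logDT : C(UnitAddCircle, ℝ) :=
  ⟨fun x => Real.log (E.DT x), E.continuous_DT.log fun x => (E.DT_pos x).ne'⟩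

@[simp] theorem logDT_apply (x : UnitAddCircle) : E.logDT x = Real.log (E.DT x) := rfl

theorem continuous_Tt : Continuous fun p : ℝ × UnitAddCircle => E.Tt p.1 p.2 :=
  E.continuous_T.comp
    (continuous_snd.add ((AddCircle.continuous_mk' 1).comp continuous_fst))

/-! ### The noise -/

theorem noise_eq : E.noise =
    ENNReal.ofReal (2 * E.ϑ)⁻¹ • volume.restrict (Set.Icc (-E.ϑ) E.ϑ) := by
  have h := E.ϑ_pos
  rw [noise, ProbabilityTheory.cond, Real.volume_Icc, ENNReal.ofReal_inv_of_pos (by positivity)]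
  congr 3
  ring

theorem integral_noise (f : ℝ → ℝ) :
    ∫ a, f a ∂E.noise = (2 * E.ϑ)⁻¹ * ∫ a in -E.ϑ..E.ϑ, f a := by
  have h := E.ϑ_pos
  rw [noise_eq, integral_smul_measure, intervalIntegral.integral_of_le (by linarith),
    integral_Icc_eq_integral_Ioc, ENNReal.toReal_ofReal (by positivity), smul_eq_mul]

theorem integrable_noise {f : ℝ → ℝ} (hf : Measurable f) {C : ℝ} (hC : ∀ a, |f a| ≤ C) :
    Integrable f E.noise :=
  Integrable.of_bound hf.aestronglyMeasurable C (Eventually.of_forall hC)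

theorem continuous_add_coe (x : UnitAddCircle) :
    Continuous fun a : ℝ => x + (a : UnitAddCircle) :=
  continuous_const.add (AddCircle.continuous_mk' 1)

theorem integrable_comp_add (g : C(UnitAddCircle, ℝ)) (x : UnitAddCircle) :
    Integrable (fun a : ℝ => g (x + (a : UnitAddCircle))) E.noise :=
  E.integrable_noise (g.continuous.comp (continuous_add_coe x)).measurable
    (C := ‖g‖) fun _ => g.norm_coe_le_norm _

/-- A nonnegative continuous function which is positive somewhere on `[-ϑ, ϑ]` has positive
expectation. -/
theorem integral_noise_pos {f : ℝ → ℝ} (hf : Continuous f) (h0 : ∀ a, 0 ≤ f a) {c : ℝ}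
    (hc : c ∈ Set.Icc (-E.ϑ) E.ϑ) (hfc : 0 < f c) : 0 < ∫ a, f a ∂E.noise := by
  have h := E.ϑ_pos
  rw [integral_noise]
  exact mul_pos (by positivity) (intervalIntegral.integral_pos (by linarith) hf.continuousOn
    (fun a _ => h0 a) ⟨c, hc, hfc⟩)

/-! ### Averaging and transfer operators -/

/-- Averaging over the noise: `(avg g) x = 𝔼 [g (x + ω₀)]`. -/
def avg : C(UnitAddCircle, ℝ) →L[ℝ] C(UnitAddCircle, ℝ) :=
  LinearMap.mkContinuous
    { toFun := fun g => ⟨fun x => ∫ a, g (x + (a : UnitAddCircle)) ∂E.noise, by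
        refine continuous_of_dominated (bound := fun _ => ‖g‖) (fun x => ?_) (fun _ => ?_)
          (integrable_const _) (Eventually.of_forall fun a => ?_)
        · exact (E.integrable_comp_add g x).aestronglyMeasurable
        · exact Eventually.of_forall fun _ => g.norm_coe_le_norm _
        · exact g.continuous.comp (continuous_id.add continuous_const)⟩
      map_add' := fun f g => by
        ext x
        exact integral_add (E.integrable_comp_add f x) (E.integrable_comp_add g x)
      map_smul' := fun c g => by
        ext x
        exact integral_const_mul c _ } 1 (fun g => by
    rw [one_mul, ContinuousMap.norm_le _ (norm_nonneg g)]
    intro x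
    refine (norm_integral_le_of_norm_le_const (C := ‖g‖)
      (Eventually.of_forall fun a => g.norm_coe_le_norm _)).trans ?_
    simp)

theorem avg_apply (g : C(UnitAddCircle, ℝ)) (x : UnitAddCircle) :
    E.avg g x = ∫ a, g (x + (a : UnitAddCircle)) ∂E.noise := rfl

theorem avg_nonneg {g : C(UnitAddCircle, ℝ)} (hg : 0 ≤ g) : 0 ≤ E.avg g := fun _ =>
  integral_nonneg fun _ => hg _

/-- The weight `(DT)^q` as an element of the Banach algebra of continuous functions, written as an
exponential so that its smooth dependence on `q` is manifest. -/
def weight (q : ℝ) : C(UnitAddCircle, ℝ) := NormedSpace.exp (q • E.logDT)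

theorem weight_apply (q : ℝ) (x : UnitAddCircle) : E.weight q x = E.DT x ^ q := by
  have h := NormedSpace.map_exp (ContinuousMap.evalAlgHom ℝ ℝ x)
    (continuous_eval_const x) (q • E.logDT)
  simp only [ContinuousMap.evalAlgHom_apply] at h
  rw [weight, h, ← Real.exp_eq_exp_ℝ, Real.rpow_def_of_pos (E.DT_pos x)]
  simp [mul_comm]

theorem weight_pos (q : ℝ) (x : UnitAddCircle) : 0 < E.weight q x := by
  rw [weight_apply]
  exact Real.rpow_pos_of_pos (E.DT_pos x) q

theorem weight_zero : E.weight 0 = 1 := by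
  rw [weight, zero_smul, NormedSpace.exp_zero]

/-- Composition with the circle map, as an operator on continuous functions. -/
def koopman : C(UnitAddCircle, ℝ) →L[ℝ] C(UnitAddCircle, ℝ) := E.TC.compCLM ℝ ℝ

@[simp] theorem koopman_apply (f : C(UnitAddCircle, ℝ)) (x : UnitAddCircle) :
    E.koopman f x = f (E.T x) := rfl

/-- The tilted transfer operator `P_q f (x) = 𝔼 [(DT_ω (x))^q f (T_ω x)]`. -/
def transfer (q : ℝ) : C(UnitAddCircle, ℝ) →L[ℝ] C(UnitAddCircle, ℝ) :=
  E.avg ∘L (ContinuousLinearMap.mul ℝ _ (E.weight q)) ∘L E.koopman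

theorem transfer_eq (q : ℝ) (f : C(UnitAddCircle, ℝ)) :
    E.transfer q f = E.avg (E.weight q * E.koopman f) := rfl

theorem transfer_apply (q : ℝ) (f : C(UnitAddCircle, ℝ)) (x : UnitAddCircle) :
    E.transfer q f x = ∫ a, E.DTt a x ^ q * f (E.Tt a x) ∂E.noise := by
  rw [transfer_eq, avg_apply]
  refine integral_congr_ae (Eventually.of_forall fun a => ?_)
  simp [weight_apply, DTt, Tt]

theorem transfer_zero_apply (f : C(UnitAddCircle, ℝ)) (x : UnitAddCircle) :
    E.transfer 0 f x = ∫ a, f (E.Tt a x) ∂E.noise := by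
  simp [transfer_apply]

theorem transfer_zero_one : E.transfer 0 1 = 1 := by
  ext x
  simp [transfer_zero_apply]

theorem weight_mul_koopman_nonneg (q : ℝ) {f : C(UnitAddCircle, ℝ)} (hf : 0 ≤ f) :
    0 ≤ E.weight q * E.koopman f := fun x =>
  mul_nonneg (E.weight_pos q x).le (hf _)

theorem transfer_nonneg (q : ℝ) {f : C(UnitAddCircle, ℝ)} (hf : 0 ≤ f) :
    0 ≤ E.transfer q f :=
  E.avg_nonneg (E.weight_mul_koopman_nonneg q hf)

theorem transfer_pow_nonneg (q : ℝ) (n : ℕ) {f : C(UnitAddCircle, ℝ)} (hf : 0 ≤ f) :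
    0 ≤ (E.transfer q ^ n) f := by
  induction n with
  | zero => simpa using hf
  | succ n ih => rw [pow_succ']; exact E.transfer_nonneg q ih

theorem transfer_pow_mono (q : ℝ) (n : ℕ) {f g : C(UnitAddCircle, ℝ)} (hfg : f ≤ g) :
    (E.transfer q ^ n) f ≤ (E.transfer q ^ n) g := by
  have h := E.transfer_pow_nonneg q n (sub_nonneg.2 hfg)
  rw [map_sub] at h
  exact sub_nonneg.1 h

/-- If the function is positive at some point reachable in `n` steps, then its image under the
`n`-th power of the transfer operator is positive at the starting point. -/
theorem transfer_pow_pos (q : ℝ) (n : ℕ) {f : C(UnitAddCircle, ℝ)} (hf : 0 ≤ f)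
    {x : UnitAddCircle} {ω : ℕ → ℝ} (hω : ∀ i, ω i ∈ Set.Icc (-E.ϑ) E.ϑ)
    (hx : 0 < f (E.iter ω n x)) : 0 < (E.transfer q ^ n) f x := by
  induction n generalizing f with
  | zero => simpa [iter] using hx
  | succ n ih =>
    rw [pow_succ]
    refine ih (E.transfer_nonneg q hf) ?_
    change 0 < E.avg (E.weight q * E.koopman f) _
    refine E.integral_noise_pos
      ((E.weight q * E.koopman f).continuous.comp (continuous_add_coe _))
      (fun a => E.weight_mul_koopman_nonneg q hf _) (hω n) ?_
    exact mul_pos (E.weight_pos q _) hx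

/-! ### Harnack inequality -/

theorem exists_coe_eq_abs_eq_norm (u : UnitAddCircle) :
    ∃ t : ℝ, (t : UnitAddCircle) = u ∧ |t| = ‖u‖ := by
  induction u using QuotientAddGroup.induction_on with
  | H x =>
    refine ⟨x - round x, ?_, UnitAddCircle.norm_eq.symm⟩
    have h : ((round x : ℝ) : UnitAddCircle) = 0 :=
      (AddCircle.coe_eq_zero_iff 1).2 ⟨round x, by simp⟩
    rw [AddCircle.coe_sub, h, sub_zero]

theorem avg_add_coe (g : C(UnitAddCircle, ℝ)) (x : UnitAddCircle) (s : ℝ) :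
    E.avg g (x + (s : UnitAddCircle)) =
      (2 * E.ϑ)⁻¹ * ∫ b in (s - E.ϑ)..(s + E.ϑ), g (x + (b : UnitAddCircle)) := by
  rw [avg_apply, integral_noise]
  have h := intervalIntegral.integral_comp_add_left (a := -E.ϑ) (b := E.ϑ)
    (fun b : ℝ => g (x + (b : UnitAddCircle))) s
  rw [show s + -E.ϑ = s - E.ϑ by ring] at h
  rw [← h]
  simp only [AddCircle.coe_add, add_assoc]

/-- An average over a window of length `2ϑ` keeps half of any of its values on a whole ball of
radius `ϑ / 2`: one half of the window at the given point carries half of the mass, and it is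
contained in the windows of all points of that half. -/
theorem exists_ball_half_le_avg {g : C(UnitAddCircle, ℝ)} (hg : 0 ≤ g) (y : UnitAddCircle) :
    ∃ z, ∀ x, dist x z ≤ E.ϑ / 2 → E.avg g y / 2 ≤ E.avg g x := by
  have hϑ := E.ϑ_pos
  set G : ℝ → ℝ := fun b => g (y + (b : UnitAddCircle)) with hG
  have hGc : Continuous G := g.continuous.comp (continuous_add_coe y)
  have hG0 : ∀ b, 0 ≤ G b := fun b => hg _
  have key : ∀ p : ℝ, E.avg g y / 2 ≤ (2 * E.ϑ)⁻¹ * ∫ b in p..(p + E.ϑ), G b →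
      ∃ z, ∀ x, dist x z ≤ E.ϑ / 2 → E.avg g y / 2 ≤ E.avg g x := by
    intro p hp
    refine ⟨y + ((p + E.ϑ / 2 : ℝ) : UnitAddCircle), fun x hx => hp.trans ?_⟩
    obtain ⟨t, ht, htn⟩ := exists_coe_eq_abs_eq_norm (x - (y + ((p + E.ϑ / 2 : ℝ) : UnitAddCircle)))
    rw [dist_eq_norm, ← htn, abs_le] at hx
    have hxe : x = y + ((p + E.ϑ / 2 + t : ℝ) : UnitAddCircle) := by
      rw [AddCircle.coe_add, ht]
      abel
    rw [hxe, avg_add_coe]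
    refine mul_le_mul_of_nonneg_left ?_ (by positivity)
    exact intervalIntegral.integral_mono_interval (by linarith) (by linarith) (by linarith)
      (Eventually.of_forall hG0) (hGc.intervalIntegrable _ _)
  have hsum : E.avg g y = (2 * E.ϑ)⁻¹ * (∫ b in -E.ϑ..(-E.ϑ + E.ϑ), G b)
      + (2 * E.ϑ)⁻¹ * ∫ b in (0 : ℝ)..(0 + E.ϑ), G b := by
    rw [avg_apply, integral_noise, ← mul_add, neg_add_cancel, zero_add,
      intervalIntegral.integral_add_adjacent_intervals (hGc.intervalIntegrable _ _)
        (hGc.intervalIntegrable _ _)]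
  by_cases hp : E.avg g y / 2 ≤ (2 * E.ϑ)⁻¹ * ∫ b in -E.ϑ..(-E.ϑ + E.ϑ), G b
  · exact key _ hp
  · exact key 0 (by linarith)

/-- Tent function of height one and radius `ϑ / 2` around the first argument. -/
def tent : C(UnitAddCircle, C(UnitAddCircle, ℝ)) :=
  ContinuousMap.curry
    ⟨fun p : UnitAddCircle × UnitAddCircle => max 0 (1 - dist p.2 p.1 * (2 / E.ϑ)), by fun_prop⟩

theorem tent_apply (z x : UnitAddCircle) :
    E.tent z x = max 0 (1 - dist x z * (2 / E.ϑ)) := rfl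

theorem tent_nonneg (z : UnitAddCircle) : 0 ≤ E.tent z := fun _ => le_max_left _ _

/-- Harnack inequality for the tilted transfer operators. -/
theorem harnack (hmin : E.Minorising) :
    ∃ k : ℕ, ∀ q : ℝ, ∃ c : ℝ, 0 < c ∧ ∀ f : C(UnitAddCircle, ℝ), 0 ≤ f →
      ∀ x y, c * E.transfer q f y ≤ (E.transfer q ^ (k + 1)) f x := by
  have hϑ := E.ϑ_pos
  obtain ⟨k, -, hk⟩ := hmin
  refine ⟨k, fun q => ?_⟩
  have hpos : ∀ z x, 0 < (E.transfer q ^ k) (E.tent z) x := by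
    intro z x
    obtain ⟨ω, hω, hx⟩ := hk x z
    refine E.transfer_pow_pos q k (E.tent_nonneg z) hω ?_
    rw [hx, tent_apply]
    simp
  have hcont : Continuous fun p : UnitAddCircle × UnitAddCircle =>
      (E.transfer q ^ k) (E.tent p.1) p.2 :=
    ContinuousEval.continuous_eval.comp
      ((((E.transfer q ^ k).continuous.comp E.tent.continuous).comp continuous_fst).prodMk
        continuous_snd)
  obtain ⟨c, hc, hcle⟩ : ∃ c : ℝ, 0 < c ∧ ∀ z x, c ≤ (E.transfer q ^ k) (E.tent z) x := by
    obtain ⟨p, -, hp⟩ := isCompact_univ.exists_isMinOn Set.univ_nonempty hcont.continuousOn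
    exact ⟨_, hpos p.1 p.2, fun z x => isMinOn_iff.1 hp (z, x) (Set.mem_univ _)⟩
  refine ⟨c / 2, half_pos hc, fun f hf x y => ?_⟩
  obtain ⟨z, hz⟩ := E.exists_ball_half_le_avg (E.weight_mul_koopman_nonneg q hf) y
  rw [← transfer_eq] at hz
  have hle : (E.transfer q f y / 2) • E.tent z ≤ E.transfer q f := by
    intro w
    change E.transfer q f y / 2 * E.tent z w ≤ E.transfer q f w
    have h0 : 0 ≤ E.transfer q f y := E.transfer_nonneg q hf y
    rw [tent_apply]
    rcases le_total (dist w z) (E.ϑ / 2) with hw | hw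
    · have h1 : max 0 (1 - dist w z * (2 / E.ϑ)) ≤ 1 :=
        max_le zero_le_one (by have : 0 ≤ dist w z * (2 / E.ϑ) := by positivity
                               linarith)
      nlinarith [hz w hw]
    · have h1 : 1 - dist w z * (2 / E.ϑ) ≤ 0 := by
        have : E.ϑ / 2 * (2 / E.ϑ) ≤ dist w z * (2 / E.ϑ) := by gcongr
        have h2 : E.ϑ / 2 * (2 / E.ϑ) = 1 := by field_simp
        linarith
      rw [max_eq_left h1, mul_zero]
      exact E.transfer_nonneg q hf w
  have h2 : (E.transfer q ^ k) ((E.transfer q f y / 2) • E.tent z) x ≤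
      (E.transfer q ^ k) (E.transfer q f) x := E.transfer_pow_mono q k hle x
  rw [map_smul, ContinuousMap.smul_apply, smul_eq_mul] at h2
  have h3 : c ≤ (E.transfer q ^ k) (E.tent z) x := hcle z x
  have h0 : 0 ≤ E.transfer q f y := E.transfer_nonneg q hf y
  have h4 : (E.transfer q ^ (k + 1)) f x = (E.transfer q ^ k) (E.transfer q f) x := by
    rw [pow_succ, mul_apply_eq_comp]
  rw [h4]
  refine le_trans ?_ h2
  generalize (E.transfer q ^ k) (E.tent z) x = v at *
  generalize E.transfer q f y = w at *
  nlinarith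

/-! ### Splitting off the first noise variable -/

/-- Prepend a real number to a sequence. -/
def consSeq (a : ℝ) (ω : ℕ → ℝ) : ℕ → ℝ
  | 0 => a
  | n + 1 => ω n

@[simp] theorem consSeq_succ (a : ℝ) (ω : ℕ → ℝ) (n : ℕ) : consSeq a ω (n + 1) = ω n := rfl

theorem measurable_consSeq : Measurable fun p : ℝ × (ℕ → ℝ) => consSeq p.1 p.2 := by
  refine measurable_pi_iff.2 fun n => ?_
  cases n with
  | zero => exact measurable_fst
  | succ n => exact (measurable_pi_apply n).comp measurable_snd

theorem map_consSeq_infinitePi (ν : Measure ℝ) [IsProbabilityMeasure ν] :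
    (ν.prod (Measure.infinitePi fun _ : ℕ => ν)).map (fun p => consSeq p.1 p.2) =
      Measure.infinitePi fun _ : ℕ => ν := by
  refine Measure.eq_infinitePi _ fun s t ht => ?_
  classical
  -- enlarge the finite index set to an initial segment by filling in the whole line
  obtain ⟨N, hN⟩ : ∃ N, s ⊆ Finset.range (N + 1) :=
    ⟨s.sup id, fun i hi => Finset.mem_range.2 (Nat.lt_succ_of_le (Finset.le_sup (f := id) hi))⟩
  set t' : ℕ → Set ℝ := fun i => if i ∈ s then t i else Set.univ with ht'
  have ht'm : ∀ i, MeasurableSet (t' i) := fun i => by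
    simp only [ht']
    split_ifs
    exacts [ht i, MeasurableSet.univ]
  have h1 : (s : Set ℕ).pi t = (Finset.range (N + 1) : Set ℕ).pi t' := by
    ext ω
    simp only [Set.mem_pi, Finset.mem_coe, ht']
    constructor
    · intro h i _
      split_ifs with hi
      exacts [h i hi, Set.mem_univ _]
    · intro h i hi
      simpa [hi] using h i (hN hi)
  have h2 : ∏ i ∈ s, ν (t i) = ∏ i ∈ Finset.range (N + 1), ν (t' i) := by
    rw [← Finset.prod_subset hN]
    · exact Finset.prod_congr rfl fun i hi => by simp [ht', hi]
    · intro i _ hi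
      simp [ht', hi]
  have h3 : (fun p : ℝ × (ℕ → ℝ) => consSeq p.1 p.2) ⁻¹' ((Finset.range (N + 1) : Set ℕ).pi t') =
      t' 0 ×ˢ ((Finset.range N : Set ℕ).pi fun i => t' (i + 1)) := by
    ext ⟨a, ω⟩
    simp only [Set.mem_preimage, Set.mem_pi, Finset.mem_coe, Finset.mem_range, Set.mem_prod]
    constructor
    · intro h
      exact ⟨h 0 (by omega), fun i hi => h (i + 1) (by omega)⟩
    · rintro ⟨h, h'⟩ i hi
      cases i with
      | zero => exact h
      | succ i => exact h' i (by omega)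
  rw [h1, h2, Measure.map_apply measurable_consSeq
    (MeasurableSet.pi (Set.to_countable _) fun i _ => ht'm i), h3, Measure.prod_prod,
    Measure.infinitePi_pi _ (fun i _ => ht'm _), Finset.prod_range_succ', mul_comm]

theorem measurePreserving_consSeq :
    MeasurePreserving (fun p : ℝ × (ℕ → ℝ) => consSeq p.1 p.2) (E.noise.prod E.ℙ) E.ℙ :=
  ⟨measurable_consSeq, map_consSeq_infinitePi E.noise⟩

instance : IsProbabilityMeasure E.ℙ := by
  unfold ℙ
  infer_instance

theorem iter_consSeq (a : ℝ) (ω : ℕ → ℝ) (n : ℕ) (x : UnitAddCircle) :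
    E.iter (consSeq a ω) (n + 1) x = E.iter ω n (E.Tt a x) := by
  induction n with
  | zero => rfl
  | succ n ih => rw [iter, ih, iter, consSeq_succ]

theorem iterDeriv_consSeq (a : ℝ) (ω : ℕ → ℝ) (n : ℕ) (x : UnitAddCircle) :
    E.iterDeriv (consSeq a ω) (n + 1) x = E.DTt a x * E.iterDeriv ω n (E.Tt a x) := by
  rw [iterDeriv, Finset.prod_range_succ', mul_comm]
  simp only [iter_consSeq, consSeq_succ]
  rfl

theorem DTt_pos (a : ℝ) (x : UnitAddCircle) : 0 < E.DTt a x := E.DT_pos _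

theorem iterDeriv_pos (ω : ℕ → ℝ) (n : ℕ) (x : UnitAddCircle) : 0 < E.iterDeriv ω n x :=
  Finset.prod_pos fun _ _ => E.DTt_pos _ _

theorem measurable_iter (n : ℕ) :
    Measurable fun p : (ℕ → ℝ) × UnitAddCircle => E.iter p.1 n p.2 := by
  induction n with
  | zero => exact measurable_snd
  | succ n ih =>
    exact E.continuous_Tt.measurable.comp
      (((measurable_pi_apply n).comp measurable_fst).prodMk ih)

theorem measurable_iterDeriv (n : ℕ) (x : UnitAddCircle) :
    Measurable fun ω : ℕ → ℝ => E.iterDeriv ω n x := by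
  refine Finset.measurable_prod _ fun i _ => ?_
  have h : Measurable fun ω : ℕ → ℝ => E.iter ω i x :=
    (E.measurable_iter i).comp (measurable_id.prodMk measurable_const)
  exact E.continuous_DT.measurable.comp
    (h.add ((AddCircle.continuous_mk' 1).measurable.comp (measurable_pi_apply i)))

theorem exists_iterDeriv_rpow_le (q : ℝ) (n : ℕ) :
    ∃ C : ℝ, ∀ (ω : ℕ → ℝ) (x : UnitAddCircle), E.iterDeriv ω n x ^ q ≤ C := by
  refine ⟨∏ _i ∈ Finset.range n, ‖E.weight q‖, fun ω x => ?_⟩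
  rw [iterDeriv, ← Real.finsetProd_rpow _ _ fun _ _ => (E.DTt_pos _ _).le]
  refine Finset.prod_le_prod (fun _ _ => Real.rpow_nonneg (E.DTt_pos _ _).le _) fun i _ => ?_
  rw [DTt, ← weight_apply]
  exact (le_abs_self _).trans ((E.weight q).norm_coe_le_norm _)

theorem integrable_iterDeriv_rpow (q : ℝ) (n : ℕ) (x : UnitAddCircle) :
    Integrable (fun ω => E.iterDeriv ω n x ^ q) E.ℙ := by
  obtain ⟨C, hC⟩ := E.exists_iterDeriv_rpow_le q n
  refine Integrable.of_bound ((E.measurable_iterDeriv n x).pow_const q).aestronglyMeasurable C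
    (Eventually.of_forall fun ω => ?_)
  rw [Real.norm_of_nonneg (Real.rpow_nonneg (E.iterDeriv_pos _ _ _).le _)]
  exact hC ω x

/-- Moments of the derivative of the random iterates are powers of the transfer operator. -/
theorem integral_iterDeriv_rpow (q : ℝ) (n : ℕ) (x : UnitAddCircle) :
    ∫ ω, E.iterDeriv ω n x ^ q ∂E.ℙ = (E.transfer q ^ n) 1 x := by
  induction n generalizing x with
  | zero => simp [iterDeriv]
  | succ n ih =>
    have hmp := E.measurePreserving_consSeq
    rw [← hmp.map_eq, integral_map hmp.measurable.aemeasurable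
      ((E.measurable_iterDeriv _ x).pow_const q).aestronglyMeasurable, integral_prod,
      pow_succ']
    · change _ = E.transfer q ((E.transfer q ^ n) 1) x
      rw [transfer_apply]
      refine integral_congr_ae (Eventually.of_forall fun a => ?_)
      simp only [iterDeriv_consSeq]
      rw [← ih, ← integral_const_mul]
      refine integral_congr_ae (Eventually.of_forall fun ω => ?_)
      exact Real.mul_rpow (E.DTt_pos _ _).le (E.iterDeriv_pos _ _ _).le
    · exact hmp.integrable_comp_of_integrable (E.integrable_iterDeriv_rpow q (n + 1) x)

/-! ### Existence of the moment Lyapunov function -/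

theorem exists_weight_bound (q : ℝ) : ∃ b : ℝ, 0 < b ∧ ∀ x, b ≤ E.weight q x := by
  obtain ⟨p, -, hp⟩ := isCompact_univ.exists_isMinOn (Set.univ_nonempty (α := UnitAddCircle))
    (E.weight q).continuous.continuousOn
  exact ⟨E.weight q p, E.weight_pos q p, fun x => isMinOn_iff.1 hp x (Set.mem_univ _)⟩

theorem transfer_pow_succ_apply (q : ℝ) (n : ℕ) (f : C(UnitAddCircle, ℝ)) :
    (E.transfer q ^ (n + 1)) f = E.transfer q ((E.transfer q ^ n) f) := by
  rw [pow_succ']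
  rfl

theorem exists_pow_le_transfer_pow (q : ℝ) :
    ∃ b : ℝ, 0 < b ∧ ∀ (n : ℕ) (x : UnitAddCircle), b ^ n ≤ (E.transfer q ^ n) 1 x := by
  obtain ⟨b, hb, h⟩ := E.exists_weight_bound q
  refine ⟨b, hb, fun n => ?_⟩
  induction n with
  | zero => intro x; simp
  | succ n ih =>
    intro x
    rw [transfer_pow_succ_apply, transfer_apply, pow_succ']
    have hint : Integrable (fun a => E.DTt a x ^ q * (E.transfer q ^ n) 1 (E.Tt a x)) E.noise := by
      have := E.integrable_comp_add (E.weight q * E.koopman ((E.transfer q ^ n) 1)) x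
      simpa [weight_apply, DTt, Tt] using this
    have h1 : ∫ _a, b * b ^ n ∂E.noise ≤
        ∫ a, E.DTt a x ^ q * (E.transfer q ^ n) 1 (E.Tt a x) ∂E.noise := by
      refine integral_mono (integrable_const _) hint fun a => ?_
      have h2 := h (x + (a : UnitAddCircle))
      rw [weight_apply] at h2
      exact mul_le_mul h2 (ih _) (by positivity) (Real.rpow_nonneg (E.DTt_pos _ _).le _)
    simpa using h1

theorem transfer_pow_one_pos (q : ℝ) (n : ℕ) (x : UnitAddCircle) :
    0 < (E.transfer q ^ n) 1 x := by
  obtain ⟨b, hb, h⟩ := E.exists_pow_le_transfer_pow q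
  exact (pow_pos hb n).trans_le (h n x)

theorem momentRate_eq (q : ℝ) (x : UnitAddCircle) (n : ℕ) :
    E.momentRate q x n = Real.log ((E.transfer q ^ n) 1 x) / n := by
  rw [momentRate, integral_iterDeriv_rpow]
  ring

theorem norm_transfer_pow_one_pos (q : ℝ) (n : ℕ) : 0 < ‖(E.transfer q ^ n) 1‖ :=
  (E.transfer_pow_one_pos q n 0).trans_le
    ((le_abs_self _).trans (((E.transfer q ^ n) 1).norm_coe_le_norm 0))

theorem norm_transfer_pow_add_one_le (q : ℝ) (m n : ℕ) :
    ‖(E.transfer q ^ (m + n)) 1‖ ≤ ‖(E.transfer q ^ m) 1‖ * ‖(E.transfer q ^ n) 1‖ := by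
  rw [ContinuousMap.norm_le _ (by positivity)]
  intro x
  have h0 : (E.transfer q ^ n) 1 ≤ ‖(E.transfer q ^ n) 1‖ • (1 : C(UnitAddCircle, ℝ)) := fun y => by
    simpa using (le_abs_self _).trans (((E.transfer q ^ n) 1).norm_coe_le_norm y)
  have h1 : (E.transfer q ^ m) ((E.transfer q ^ n) 1) x ≤
      (E.transfer q ^ m) (‖(E.transfer q ^ n) 1‖ • (1 : C(UnitAddCircle, ℝ))) x :=
    E.transfer_pow_mono q m h0 x
  rw [map_smul, ContinuousMap.smul_apply, smul_eq_mul] at h1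
  rw [Real.norm_of_nonneg (E.transfer_pow_one_pos q _ x).le, pow_add]
  refine h1.trans ?_
  rw [mul_comm]
  gcongr
  exact (le_abs_self _).trans (((E.transfer q ^ m) 1).norm_coe_le_norm x)

/-- A sequence staying within bounded logarithmic distance of `u` has the same growth rate. -/
theorem tendsto_log_div_of_bounds {a : ℕ → ℝ} {u : ℕ → ℝ} {L c C : ℝ} {N : ℕ} (hc : 0 < c)
    (hC : 0 < C) (hL : Tendsto (fun n => u n / n) atTop (𝓝 L))
    (h1 : ∀ n ≥ N, c * Real.exp (u n) ≤ a n) (h2 : ∀ n ≥ N, a n ≤ C * Real.exp (u n)) :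
    Tendsto (fun n => Real.log (a n) / n) atTop (𝓝 L) := by
  have e1 : Tendsto (fun n : ℕ => Real.log c / n + u n / n) atTop (𝓝 L) := by
    simpa using (tendsto_const_div_atTop_nhds_zero_nat (Real.log c)).add hL
  have e2 : Tendsto (fun n : ℕ => Real.log C / n + u n / n) atTop (𝓝 L) := by
    simpa using (tendsto_const_div_atTop_nhds_zero_nat (Real.log C)).add hL
  refine tendsto_of_tendsto_of_tendsto_of_le_of_le' e1 e2 ?_ ?_
  · filter_upwards [eventually_ge_atTop N] with n hn
    rw [← add_div]
    gcongr
    have := Real.log_le_log (by positivity) (h1 n hn)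
    rwa [Real.log_mul hc.ne' (Real.exp_pos _).ne', Real.log_exp] at this
  · filter_upwards [eventually_ge_atTop N] with n hn
    rw [← add_div]
    gcongr
    have h0 : 0 < a n := lt_of_lt_of_le (by positivity) (h1 n hn)
    have := Real.log_le_log h0 (h2 n hn)
    rwa [Real.log_mul hC.ne' (Real.exp_pos _).ne', Real.log_exp] at this

/-- The moments grow exponentially at a rate which does not depend on the initial point: their
supremum is submultiplicative and comparable to all values by the Harnack inequality. -/
theorem tendsto_momentRate (hmin : E.Minorising) (q : ℝ) (x : UnitAddCircle) :
    Tendsto (E.momentRate q x) atTop (𝓝 (E.momentLyapunov q)) := by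
  suffices h : ∃ L, ∀ x, Tendsto (E.momentRate q x) atTop (𝓝 L) by
    obtain ⟨L, hL⟩ := h
    rw [momentLyapunov, (hL 0).limUnder_eq]
    exact hL x
  set u : ℕ → ℝ := fun n => Real.log ‖(E.transfer q ^ n) 1‖ with hu
  have hexp : ∀ n, Real.exp (u n) = ‖(E.transfer q ^ n) 1‖ := fun n =>
    Real.exp_log (E.norm_transfer_pow_one_pos q n)
  have hsub : Subadditive u := fun m n => by
    have := Real.log_le_log (E.norm_transfer_pow_one_pos q _)
      (E.norm_transfer_pow_add_one_le q m n)
    rwa [Real.log_mul (E.norm_transfer_pow_one_pos q _).ne'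
      (E.norm_transfer_pow_one_pos q _).ne'] at this
  have hbdd : BddBelow (Set.range fun n => u n / n) := by
    obtain ⟨b, hb, h⟩ := E.exists_pow_le_transfer_pow q
    refine ⟨min 0 (Real.log b), ?_⟩
    rintro _ ⟨n, rfl⟩
    rcases Nat.eq_zero_or_pos n with rfl | hn
    · simp
    · refine (min_le_right _ _).trans ?_
      have hn' : (0 : ℝ) < n := by exact_mod_cast hn
      simp only []
      rw [le_div_iff₀ hn', mul_comm, ← Real.log_pow]
      refine Real.log_le_log (by positivity) ((h n 0).trans ?_)
      exact (le_abs_self _).trans (((E.transfer q ^ n) 1).norm_coe_le_norm 0)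
  have hlim := hsub.tendsto_lim hbdd
  refine ⟨hsub.lim, fun x => ?_⟩
  obtain ⟨k, hk⟩ := E.harnack hmin
  obtain ⟨c, hc, hcle⟩ := hk q
  have hM := E.norm_transfer_pow_one_pos q
  have key : ∀ n ≥ k + 1, c / ‖(E.transfer q ^ k) 1‖ * Real.exp (u n) ≤ (E.transfer q ^ n) 1 x := by
    intro n hn
    obtain ⟨m, rfl⟩ := Nat.exists_eq_add_of_le' hn
    have h1 : c * ‖(E.transfer q ^ (m + 1)) 1‖ ≤ (E.transfer q ^ (m + (k + 1))) 1 x := by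
      rw [mul_comm, ← le_div_iff₀ hc, ContinuousMap.norm_le]
      · intro y
        rw [Real.norm_of_nonneg (E.transfer_pow_one_pos q _ y).le, le_div_iff₀ hc, mul_comm,
          transfer_pow_succ_apply, add_comm m, pow_add]
        exact hcle _ (fun z => (E.transfer_pow_one_pos q m z).le) x y
      · exact div_nonneg (E.transfer_pow_one_pos q _ x).le hc.le
    have h2 := E.norm_transfer_pow_add_one_le q k (m + 1)
    rw [hexp, div_mul_eq_mul_div, div_le_iff₀ (hM k)]
    rw [show k + (m + 1) = m + (k + 1) by ring] at h2
    nlinarith [hM k]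
  refine (tendsto_log_div_of_bounds (div_pos hc (hM k)) one_pos hlim key ?_).congr
    fun n => (E.momentRate_eq q x n).symm
  intro n _
  rw [one_mul, hexp]
  exact (le_abs_self _).trans (((E.transfer q ^ n) 1).norm_coe_le_norm x)

/-- A positive eigenfunction determines the moment Lyapunov function. -/
theorem momentLyapunov_eq_log {q r : ℝ} (hr : 0 < r) {f : C(UnitAddCircle, ℝ)}
    {m : ℝ} (hm : 0 < m) (hmf : ∀ x, m ≤ f x) (hf : E.transfer q f = r • f) :
    E.momentLyapunov q = Real.log r := by
  have hpow : ∀ n : ℕ, (E.transfer q ^ n) f = r ^ n • f := by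
    intro n
    induction n with
    | zero => simp
    | succ n ih => rw [transfer_pow_succ_apply, ih, map_smul, hf, smul_smul, pow_succ]
  have hfn : ∀ x, f x ≤ ‖f‖ := fun x => (le_abs_self _).trans (f.norm_coe_le_norm x)
  have hM : 0 < ‖f‖ := hm.trans_le ((hmf 0).trans (hfn 0))
  have hexp : ∀ n : ℕ, Real.exp (n * Real.log r) = r ^ n := fun n => by
    rw [Real.exp_nat_mul, Real.exp_log hr]
  have hlim : Tendsto (fun n : ℕ => (n * Real.log r) / n) atTop (𝓝 (Real.log r)) := by
    refine (tendsto_const_nhds (x := Real.log r)).congr' ?_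
    filter_upwards [eventually_gt_atTop 0] with n hn
    have hn' : (n : ℝ) ≠ 0 := by positivity
    field_simp
  refine Tendsto.limUnder_eq ((tendsto_log_div_of_bounds (c := m / ‖f‖) (C := ‖f‖ / m) (N := 0)
    (by positivity) (by positivity) hlim (fun n _ => ?_) fun n _ => ?_).congr
    fun n => (E.momentRate_eq q 0 n).symm)
  · have h0 : f ≤ ‖f‖ • (1 : C(UnitAddCircle, ℝ)) := fun x => by simpa using hfn x
    have h1 : (E.transfer q ^ n) f 0 ≤ (E.transfer q ^ n) (‖f‖ • (1 : C(UnitAddCircle, ℝ))) 0 :=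
      E.transfer_pow_mono q n h0 0
    rw [hpow, map_smul, ContinuousMap.smul_apply, ContinuousMap.smul_apply, smul_eq_mul,
      smul_eq_mul] at h1
    rw [hexp, div_mul_eq_mul_div, div_le_iff₀ hM]
    nlinarith [hmf 0, pow_pos hr n]
  · have h0 : m • (1 : C(UnitAddCircle, ℝ)) ≤ f := fun x => by simpa using hmf x
    have h1 : (E.transfer q ^ n) (m • (1 : C(UnitAddCircle, ℝ))) 0 ≤ (E.transfer q ^ n) f 0 :=
      E.transfer_pow_mono q n h0 0
    rw [hpow, map_smul, ContinuousMap.smul_apply, ContinuousMap.smul_apply, smul_eq_mul,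
      smul_eq_mul] at h1
    rw [hexp, div_mul_eq_mul_div, le_div_iff₀ hm]
    nlinarith [hfn 0, pow_pos hr n]

/-! ### The stationary measure and the spectral gap -/

/-- Integration against a probability measure, as a functional on continuous functions. -/
def mean (μ : Measure UnitAddCircle) [IsProbabilityMeasure μ] : C(UnitAddCircle, ℝ) →L[ℝ] ℝ :=
  LinearMap.mkContinuous
    { toFun := fun f => ∫ x, f x ∂μ
      map_add' := fun f g => integral_add
        (f.continuous.integrable_of_hasCompactSupport (HasCompactSupport.of_compactSpace f))
        (g.continuous.integrable_of_hasCompactSupport (HasCompactSupport.of_compactSpace g))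
      map_smul' := fun c _ => integral_const_mul c _ } 1 (fun f => by
    refine (norm_integral_le_of_norm_le_const (C := ‖f‖)
      (Eventually.of_forall fun x => f.norm_coe_le_norm _)).trans ?_
    simp)

section Stationary

variable {E} {μ : Measure UnitAddCircle} [IsProbabilityMeasure μ]

theorem mean_apply (f : C(UnitAddCircle, ℝ)) : mean μ f = ∫ x, f x ∂μ := rfl

theorem mean_one : mean μ 1 = 1 := by simp [mean_apply]

theorem mean_nonneg {f : C(UnitAddCircle, ℝ)} (hf : 0 ≤ f) : 0 ≤ mean μ f :=
  integral_nonneg hf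

theorem mean_mono {f g : C(UnitAddCircle, ℝ)} (h : f ≤ g) : mean μ f ≤ mean μ g := by
  have := mean_nonneg (μ := μ) (sub_nonneg.2 h)
  rw [map_sub] at this
  exact sub_nonneg.1 this

theorem mean_le_of_le {f : C(UnitAddCircle, ℝ)} {c : ℝ} (h : ∀ x, f x ≤ c) : mean μ f ≤ c := by
  have : mean μ f ≤ mean μ (c • 1) := mean_mono fun x => by simpa using h x
  rwa [map_smul, mean_one, smul_eq_mul, mul_one] at this

theorem IsStationary.map_prod (hμ : E.IsStationary μ) :
    (E.noise.prod μ).map (fun p => E.Tt p.1 p.2) = μ := by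
  ext A hA
  have hm : Measurable fun p : ℝ × UnitAddCircle => E.Tt p.1 p.2 := E.continuous_Tt.measurable
  rw [Measure.map_apply hm hA, Measure.prod_apply (hm hA), ← hμ A hA]
  rfl

theorem IsStationary.mean_transfer (hμ : E.IsStationary μ) (f : C(UnitAddCircle, ℝ)) :
    mean μ (E.transfer 0 f) = mean μ f := by
  have hm : Measurable fun p : ℝ × UnitAddCircle => E.Tt p.1 p.2 := E.continuous_Tt.measurable
  conv_rhs => rw [mean_apply, ← hμ.map_prod]
  rw [integral_map hm.aemeasurable f.continuous.aestronglyMeasurable, integral_prod_symm, mean_apply]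
  · simp only [transfer_zero_apply]
  · exact Integrable.of_bound (f.continuous.measurable.comp hm).aestronglyMeasurable ‖f‖
      (Eventually.of_forall fun p => f.norm_coe_le_norm _)

/-- The projection `f ↦ μ(f) 1` onto constants. -/
def meanProj (μ : Measure UnitAddCircle) [IsProbabilityMeasure μ] :
    C(UnitAddCircle, ℝ) →L[ℝ] C(UnitAddCircle, ℝ) := (mean μ).smulRight 1

theorem meanProj_apply (f : C(UnitAddCircle, ℝ)) : meanProj μ f = mean μ f • 1 := rfl

theorem IsStationary.mean_transfer_pow (hμ : E.IsStationary μ) (n : ℕ) (f : C(UnitAddCircle, ℝ)) :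
    mean μ ((E.transfer 0 ^ n) f) = mean μ f := by
  induction n with
  | zero => simp
  | succ n ih => rw [transfer_pow_succ_apply, hμ.mean_transfer, ih]

theorem transfer_zero_pow_one (n : ℕ) : (E.transfer 0 ^ n) 1 = 1 := by
  induction n with
  | zero => simp
  | succ n ih => rw [transfer_pow_succ_apply, ih, transfer_zero_one]

/-- A positive operator `R` on continuous functions with `R 1 ≤ r` has norm at most `r`. -/
theorem norm_le_of_positive (R : C(UnitAddCircle, ℝ) →L[ℝ] C(UnitAddCircle, ℝ))
    (hR : ∀ f, 0 ≤ f → 0 ≤ R f) {r : ℝ} (hr : 0 ≤ r) (h1 : R 1 ≤ r • 1) : ‖R‖ ≤ r := by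
  refine ContinuousLinearMap.opNorm_le_bound _ hr fun f => ?_
  rw [ContinuousMap.norm_le _ (by positivity)]
  intro x
  have hle : ∀ g : C(UnitAddCircle, ℝ), R g x ≤ r * ‖g‖ := by
    intro g
    have h2 : 0 ≤ ‖g‖ • (1 : C(UnitAddCircle, ℝ)) - g := fun y => by
      simpa using (le_abs_self _).trans (g.norm_coe_le_norm y)
    have h3 : (0 : ℝ) ≤ R (‖g‖ • (1 : C(UnitAddCircle, ℝ)) - g) x := hR _ h2 x
    have h4 : R 1 x ≤ r := by simpa using h1 x
    rw [map_sub, map_smul, ContinuousMap.sub_apply, ContinuousMap.smul_apply, smul_eq_mul] at h3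
    nlinarith [norm_nonneg g]
  rw [Real.norm_eq_abs, abs_le]
  have h5 := hle (-f)
  rw [map_neg, norm_neg, ContinuousMap.neg_apply] at h5
  exact ⟨by linarith, hle f⟩

/-- If `Q` is an idempotent with `P Q = Q P = Q` and some power of `P` is within distance `1 - c` of
`c Q`, then `P - Q` has spectral radius less than one: with `R = Pᵏ⁺¹ - c Q` one has
`(Pᵏ⁺¹ - Q)ʲ = Rʲ (1 - Q)`. -/
theorem isUnit_one_sub_of_norm_pow_sub_le {A : Type*} [NormedRing A] [NormedAlgebra ℝ A]
    [CompleteSpace A] {P Q : A} (hQQ : Q * Q = Q) (hPQ : P * Q = Q) (hQP : Q * P = Q) {c : ℝ}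
    (hc : 0 < c) (k : ℕ) (hn : ‖P ^ (k + 1) - c • Q‖ ≤ 1 - c) : IsUnit (1 - (P - Q)) := by
  have hPnQ : ∀ n, P ^ n * Q = Q := by
    intro n
    induction n with
    | zero => simp
    | succ n ih => rw [pow_succ, mul_assoc, hPQ, ih]
  have hQPn : ∀ n, Q * P ^ n = Q := by
    intro n
    induction n with
    | zero => simp
    | succ n ih => rw [pow_succ', ← mul_assoc, hQP, ih]
  have hc1 : 0 ≤ 1 - c := (norm_nonneg _).trans hn
  obtain ⟨R, hR⟩ : ∃ R, R = P ^ (k + 1) - c • Q := ⟨_, rfl⟩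
  rw [← hR] at hn
  have hRQ : R * Q = (1 - c) • Q := by
    rw [hR, sub_mul, hPnQ, smul_mul_assoc, hQQ, sub_smul, one_smul]
  have hQR : Q * R = (1 - c) • Q := by
    rw [hR, mul_sub, hQPn, mul_smul_comm, hQQ, sub_smul, one_smul]
  have hcomm : Commute R (1 - Q) := by
    rw [Commute, SemiconjBy, mul_sub, sub_mul, hRQ, hQR, mul_one, one_mul]
  have hQc : IsIdempotentElem (1 - Q) := by
    rw [IsIdempotentElem, mul_sub, sub_mul, sub_mul, hQQ]
    simp
  have hfac : P ^ (k + 1) - Q = R * (1 - Q) := by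
    rw [mul_sub, hRQ, hR, mul_one, sub_smul, one_smul]
    abel
  have hpowQ : ∀ n, (P - Q) ^ (n + 1) = P ^ (n + 1) - Q := by
    intro n
    induction n with
    | zero => simp
    | succ n ih =>
      rw [pow_succ, ih, sub_mul, mul_sub, mul_sub, hPnQ, hQP, hQQ, ← pow_succ]
      abel
  obtain ⟨j, hj⟩ : ∃ j : ℕ, (1 - c) ^ (j + 1) * ‖1 - Q‖ < 1 := by
    have h1 : Tendsto (fun j : ℕ => (1 - c) ^ (j + 1) * ‖1 - Q‖) atTop (𝓝 (0 * ‖1 - Q‖)) :=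
      ((tendsto_pow_atTop_nhds_zero_of_lt_one hc1 (by linarith)).comp
        (tendsto_add_atTop_nat 1)).mul_const _
    rw [zero_mul] at h1
    exact (h1.eventually_lt_const one_pos).exists
  have hnorm : ‖(P - Q) ^ ((k + 1) * (j + 1))‖ < 1 := by
    rw [pow_mul, hpowQ, hfac, hcomm.mul_pow, hQc.pow_succ_eq]
    refine lt_of_le_of_lt ((norm_mul_le _ _).trans ?_) hj
    gcongr
    exact (norm_pow_le' R (Nat.succ_pos j)).trans (pow_le_pow_left₀ (norm_nonneg _) hn _)
  have hu : IsUnit (1 - (P - Q) ^ ((k + 1) * (j + 1))) := isUnit_one_sub_of_norm_lt_one hnorm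
  have hdvd : Commute (1 - (P - Q))
      (∑ i ∈ Finset.range ((k + 1) * (j + 1)), (P - Q) ^ i) :=
    Commute.sum_right _ _ _ fun i _ =>
      ((Commute.one_left _).sub_left ((Commute.refl _).pow_right i))
  rw [← mul_neg_geom_sum] at hu
  exact (hdvd.isUnit_mul_iff.1 hu).1

/-- Spectral gap: `1 - P + Π` is invertible, where `P` is the Markov operator and `Π` the projection
given by the stationary measure. By the Harnack inequality `Pᵏ⁺¹ - c Π` is a positive operator. -/
theorem IsStationary.isUnit_one_sub (hμ : E.IsStationary μ) (hmin : E.Minorising) :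
    IsUnit (1 - (E.transfer 0 - meanProj μ)) := by
  obtain ⟨k, hk⟩ := E.harnack hmin
  obtain ⟨c, hc, hcle⟩ := hk 0
  have hpos : ∀ f, 0 ≤ f → 0 ≤ (E.transfer 0 ^ (k + 1) - c • meanProj μ) f := by
    intro f hf x
    have h1 : c * mean μ f ≤ (E.transfer 0 ^ (k + 1)) f x := by
      rw [← hμ.mean_transfer, mul_comm, ← le_div_iff₀ hc]
      refine mean_le_of_le fun y => ?_
      rw [le_div_iff₀ hc, mul_comm]
      exact hcle f hf x y
    change (0 : ℝ) ≤ (E.transfer 0 ^ (k + 1)) f x - c * (mean μ f * 1)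
    linarith
  have h1 : (E.transfer 0 ^ (k + 1) - c • meanProj μ) 1 = (1 - c) • 1 := by
    change (E.transfer 0 ^ (k + 1)) 1 - c • meanProj μ 1 = _
    rw [transfer_zero_pow_one, meanProj_apply, mean_one, one_smul, sub_smul, one_smul]
  have hc1 : 0 ≤ 1 - c := by
    have h2 : (0 : ℝ) ≤ (E.transfer 0 ^ (k + 1) - c • meanProj μ) 1 0 :=
      hpos 1 (fun _ => zero_le_one) 0
    rw [h1] at h2
    simpa using h2
  refine isUnit_one_sub_of_norm_pow_sub_le (A := C(UnitAddCircle, ℝ) →L[ℝ] C(UnitAddCircle, ℝ))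
    ?_ ?_ ?_ hc k (norm_le_of_positive _ hpos hc1 h1.le)
  · ext1 f
    change meanProj μ (meanProj μ f) = meanProj μ f
    rw [meanProj_apply, meanProj_apply, map_smul, mean_one, smul_eq_mul, mul_one]
  · ext1 f
    change E.transfer 0 (meanProj μ f) = meanProj μ f
    rw [meanProj_apply, map_smul, transfer_zero_one]
  · ext1 f
    change meanProj μ (E.transfer 0 f) = meanProj μ f
    rw [meanProj_apply, meanProj_apply, hμ.mean_transfer]

end Stationary

/-! ### Smoothness of the moment Lyapunov function -/

theorem hasDerivAt_weight (q : ℝ) : HasDerivAt E.weight (E.logDT * E.weight q) q :=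
  hasDerivAt_exp_smul_const' E.logDT q

theorem contDiff_weight : ContDiff ℝ 2 E.weight := by
  have h : ContDiff ℝ 2 (NormedSpace.exp : C(UnitAddCircle, ℝ) → C(UnitAddCircle, ℝ)) :=
    contDiff_iff_contDiffAt.2 fun x => (NormedSpace.exp_analytic (𝕂 := ℝ) x).contDiffAt
  exact h.comp (contDiff_id.smul contDiff_const)

section Stationary

variable {E} {μ : Measure UnitAddCircle} [IsProbabilityMeasure μ]

variable (E μ) in
/-- The defect of the eigenfunction equation `P_q f = μ(P_q f) f`. -/
def eigenDefect (p : ℝ × C(UnitAddCircle, ℝ)) : C(UnitAddCircle, ℝ) :=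
  E.transfer p.1 p.2 - mean μ (E.transfer p.1 p.2) • p.2

theorem contDiff_eigenDefect : ContDiff ℝ 2 (eigenDefect E μ) := by
  have h : ContDiff ℝ 2 fun p : ℝ × C(UnitAddCircle, ℝ) => E.transfer p.1 p.2 :=
    E.avg.contDiff.comp ((E.contDiff_weight.comp contDiff_fst).mul
      (E.koopman.contDiff.comp contDiff_snd))
  exact h.sub (((mean μ).contDiff.comp h).smul contDiff_snd)

theorem IsStationary.fderiv_eigenDefect (hμ : E.IsStationary μ) :
    fderiv ℝ (eigenDefect E μ) (0, 1) ∘L .inr ℝ ℝ C(UnitAddCircle, ℝ) =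
      -(1 - (E.transfer 0 - meanProj μ)) := by
  have h1 : HasFDerivAt (fun f => eigenDefect E μ (0, f))
      (fderiv ℝ (eigenDefect E μ) (0, 1) ∘L .inr ℝ ℝ C(UnitAddCircle, ℝ)) 1 :=
    ((contDiff_eigenDefect.differentiable (by norm_num)) (0, 1)).hasFDerivAt.comp 1
      (hasFDerivAt_prodMk_right 0 1)
  have h2 := (E.transfer 0).hasFDerivAt (x := 1).sub
    ((((mean μ) ∘L (E.transfer 0)).hasFDerivAt (x := 1)).smul (hasFDerivAt_id 1))
  rw [h1.unique h2]
  ext1 f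
  change E.transfer 0 f - (mean μ (E.transfer 0 1) • f + mean μ (E.transfer 0 f) • 1) =
    -(f - (E.transfer 0 f - mean μ f • 1))
  rw [transfer_zero_one, mean_one, hμ.mean_transfer, one_smul]
  abel

theorem IsStationary.isInvertible_one_sub (hμ : E.IsStationary μ) (hmin : E.Minorising) :
    (-(1 - (E.transfer 0 - meanProj μ))).IsInvertible := by
  obtain ⟨u, hu⟩ := hμ.isUnit_one_sub hmin
  rw [← hu]
  exact ⟨ContinuousLinearEquiv.ofUnit (-u), rfl⟩

/-- Solvability of the Poisson equation for functions of mean zero. -/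
theorem IsStationary.exists_poisson (hμ : E.IsStationary μ) (hmin : E.Minorising)
    {g : C(UnitAddCircle, ℝ)} (hg : mean μ g = 0) :
    ∃ χ : C(UnitAddCircle, ℝ), χ - E.transfer 0 χ = g := by
  obtain ⟨χ, hχ⟩ := (hμ.isInvertible_one_sub hmin).surjective (-g)
  have h : χ - (E.transfer 0 χ - mean μ χ • 1) = g := neg_injective hχ
  have h0 : mean μ χ = 0 := by
    have := congrArg (mean μ) h
    rw [map_sub, map_sub, map_smul, mean_one, hμ.mean_transfer, hg, smul_eq_mul] at this
    linarith
  refine ⟨χ, ?_⟩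
  rw [h0, zero_smul, sub_zero] at h
  exact h

/-- For small `q` the transfer operator has a positive eigenfunction depending smoothly on `q`. -/
theorem IsStationary.exists_eigenfunctions (hμ : E.IsStationary μ) (hmin : E.Minorising) :
    ∃ φ : ℝ → C(UnitAddCircle, ℝ), ContDiffAt ℝ 2 φ 0 ∧ φ 0 = 1 ∧
      ∀ᶠ q in 𝓝 0, mean μ (φ q) = 1 ∧ (∀ x, 1 / 2 ≤ φ q x) ∧
        0 < mean μ (E.transfer q (φ q)) ∧
        E.transfer q (φ q) = mean μ (E.transfer q (φ q)) • φ q := by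
  have cdf : ContDiffAt ℝ 2 (eigenDefect E μ) ((0, 1) : ℝ × C(UnitAddCircle, ℝ)) :=
    contDiff_eigenDefect.contDiffAt
  have hinv : (fderiv ℝ (eigenDefect E μ) (0, 1) ∘L .inr ℝ ℝ C(UnitAddCircle, ℝ)).IsInvertible := by
    rw [hμ.fderiv_eigenDefect]
    exact hμ.isInvertible_one_sub hmin
  have hφ : ContDiffAt ℝ 2 (cdf.implicitFunction (by norm_num) hinv) 0 :=
    cdf.contDiffAt_implicitFunction (by norm_num) hinv
  have hφ0 : cdf.implicitFunction (by norm_num) hinv 0 = 1 :=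
    cdf.implicitFunction_apply_self (by norm_num) hinv
  have hφe := cdf.eventually_apply_implicitFunction (by norm_num) hinv
  generalize cdf.implicitFunction (by norm_num) hinv = φ at hφ hφ0 hφe
  refine ⟨φ, hφ, hφ0, ?_⟩
  have hd0 : eigenDefect E μ (0, 1) = 0 := by
    simp [eigenDefect, transfer_zero_one, mean_one]
  have htr : ContinuousAt (fun q => mean μ (E.transfer q (φ q))) 0 := by
    have h : ContinuousAt (fun q => E.weight q * E.koopman (φ q)) 0 :=
      E.contDiff_weight.continuous.continuousAt.mul (E.koopman.continuous.continuousAt.comp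
        hφ.continuousAt)
    exact ((mean μ) ∘L E.avg).continuous.continuousAt.comp h
  have hpos : ∀ᶠ q in 𝓝 (0 : ℝ), 0 < mean μ (E.transfer q (φ q)) := by
    refine htr.eventually_const_lt ?_
    beta_reduce
    rw [hφ0, transfer_zero_one, mean_one]
    exact one_pos
  have hclose : ∀ᶠ q in 𝓝 (0 : ℝ), ‖φ q - 1‖ < 1 / 2 := by
    have h : ContinuousAt (fun q => ‖φ q - 1‖) 0 := (hφ.continuousAt.sub continuousAt_const).norm
    refine h.eventually_lt_const ?_
    beta_reduce
    rw [hφ0, sub_self, norm_zero]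
    norm_num
  filter_upwards [hφe, hpos, hclose] with q h1 h2 h3
  rw [hd0, eigenDefect, sub_eq_zero] at h1
  refine ⟨?_, fun x => ?_, h2, h1⟩
  · have h4 := congrArg (mean μ) h1
    rw [map_smul, smul_eq_mul] at h4
    exact (mul_left_cancel₀ h2.ne' ((mul_one _).trans h4)).symm
  · have h4 := ((φ q - 1).norm_coe_le_norm x).trans h3.le
    rw [ContinuousMap.sub_apply, ContinuousMap.one_apply, Real.norm_eq_abs, abs_le] at h4
    linarith [h4.1]

variable (E) in
/-- Conditional second moment of the martingale increments
`ln DT_ω(x) + ψ (T_ω x) - ψ x`, where `ψ` is a corrector; see `incrementVar_apply`. -/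
def incrementVar (ψ : C(UnitAddCircle, ℝ)) : C(UnitAddCircle, ℝ) :=
  E.avg ((E.logDT + E.koopman ψ) * (E.logDT + E.koopman ψ)) - ψ * ψ

theorem avg_koopman (f : C(UnitAddCircle, ℝ)) : E.avg (E.koopman f) = E.transfer 0 f := by
  rw [transfer_eq, weight_zero, one_mul]

theorem avg_logDT_add_koopman {ψ : C(UnitAddCircle, ℝ)} (hψ : ψ - E.transfer 0 ψ = E.avg E.logDT) :
    E.avg (E.logDT + E.koopman ψ) = ψ := by
  rw [map_add, avg_koopman, ← hψ, sub_add_cancel]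

theorem incrementVar_apply {ψ : C(UnitAddCircle, ℝ)} (hψ : ψ - E.transfer 0 ψ = E.avg E.logDT)
    (x : UnitAddCircle) :
    E.incrementVar ψ x = ∫ a, (E.logDT (x + (a : UnitAddCircle)) + ψ (E.Tt a x) - ψ x) ^ 2
      ∂E.noise := by
  have h1 : E.avg (E.logDT + E.koopman ψ) x = ψ x := by rw [avg_logDT_add_koopman hψ]
  set g := E.logDT + E.koopman ψ with hg
  have h2 : ∀ a : ℝ, (E.logDT (x + (a : UnitAddCircle)) + ψ (E.Tt a x) - ψ x) ^ 2 =
      (g * g) (x + (a : UnitAddCircle)) - 2 * ψ x * g (x + (a : UnitAddCircle)) + ψ x ^ 2 := by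
    intro a
    simp only [hg, ContinuousMap.mul_apply, ContinuousMap.add_apply, koopman_apply, Tt]
    ring
  simp only [h2]
  have i1 := E.integrable_comp_add (g * g) x
  have i2 := (E.integrable_comp_add g x).const_mul (2 * ψ x)
  have i3 : Integrable (fun a : ℝ => (g * g) (x + (a : UnitAddCircle)) -
      2 * ψ x * g (x + (a : UnitAddCircle))) E.noise := i1.sub i2
  rw [integral_add i3 (integrable_const _), integral_sub i1 i2, integral_const_mul,
    ← avg_apply, ← avg_apply, h1, incrementVar]
  simp only [← hg, ContinuousMap.sub_apply, ContinuousMap.mul_apply, integral_const,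
    probReal_univ, one_smul]
  ring

/-- The moment Lyapunov function is twice differentiable at the origin, with vanishing derivative
and second derivative the mean of the conditional variance of the martingale increments. -/
theorem IsStationary.momentLyapunov_expansion (hμ : E.IsStationary μ) (hmin : E.Minorising)
    (hlyap : E.lyapunov μ = 0) :
    ContDiffAt ℝ 2 E.momentLyapunov 0 ∧
    ∃ ψ : C(UnitAddCircle, ℝ), ψ - E.transfer 0 ψ = E.avg E.logDT ∧
      mean μ (E.incrementVar ψ) = E.V ∧
      (0 < E.V → ∃ q r : ℝ, 0 < q ∧ q < 1 ∧ 1 < r ∧ ∃ φ : C(UnitAddCircle, ℝ),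
        (∀ x, 1 / 2 ≤ φ x) ∧ E.transfer q φ = r • φ) := by
  obtain ⟨φ, hφ, hφ0, hφe⟩ := hμ.exists_eigenfunctions hmin
  set r : ℝ → ℝ := fun q => mean μ (E.transfer q (φ q)) with hr
  have hr0 : r 0 = 1 := by simp [hr, hφ0, transfer_zero_one, mean_one]
  have hlogr : E.momentLyapunov =ᶠ[𝓝 0] fun q => Real.log (r q) := by
    filter_upwards [hφe] with q hq
    exact E.momentLyapunov_eq_log hq.2.2.1 (by norm_num) hq.2.1 hq.2.2.2
  have hrC : ContDiffAt ℝ 2 r 0 := by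
    have h : ContDiffAt ℝ 2 (fun q => E.weight q * E.koopman (φ q)) 0 :=
      E.contDiff_weight.contDiffAt.mul (E.koopman.contDiff.contDiffAt.comp 0 hφ)
    exact ((mean μ) ∘L E.avg).contDiff.contDiffAt.comp 0 h
  -- first derivatives near the origin, second derivatives at the origin
  have hφd : ∀ᶠ q in 𝓝 (0 : ℝ), HasDerivAt φ (deriv φ q) q := by
    filter_upwards [hφ.eventually (by decide)] with q hq
    exact (hq.differentiableAt (by norm_num)).hasDerivAt
  have hφd2 : HasDerivAt (deriv φ) (deriv (deriv φ) 0) 0 := by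
    have h : ContDiffAt ℝ 1 (deriv φ) 0 := by
      have h1 : ContDiffAt ℝ 1 (fderiv ℝ φ) 0 := hφ.fderiv_right (by norm_num)
      have h2 : deriv φ = fun q => fderiv ℝ φ q 1 := funext fun q => fderiv_apply_one_eq_deriv.symm
      rw [h2]
      exact h1.clm_apply contDiffAt_const
    exact (h.differentiableAt (by norm_num)).hasDerivAt
  set ψ := deriv φ 0 with hψ
  set G : ℝ → C(UnitAddCircle, ℝ) := fun q =>
    E.logDT * E.weight q * E.koopman (φ q) + E.weight q * E.koopman (deriv φ q) with hG
  have hGd : ∀ᶠ q in 𝓝 (0 : ℝ),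
      HasDerivAt (fun q => E.transfer q (φ q)) (E.avg (G q)) q := by
    filter_upwards [hφd] with q hq
    exact E.avg.hasFDerivAt.comp_hasDerivAt q
      ((E.hasDerivAt_weight q).mul (E.koopman.hasFDerivAt.comp_hasDerivAt q hq))
  have hrd : ∀ᶠ q in 𝓝 (0 : ℝ), HasDerivAt r (mean μ (E.avg (G q))) q := by
    filter_upwards [hGd] with q hq
    exact (mean μ).hasFDerivAt.comp_hasDerivAt q hq
  have hk1 : E.koopman 1 = 1 := rfl
  have hG0 : G 0 = E.logDT + E.koopman ψ := by
    simp only [hG, weight_zero, hφ0, hk1, mul_one, one_mul, ← hψ]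
  have hG2 : HasDerivAt G (E.logDT * E.logDT + 2 * (E.logDT * E.koopman ψ)
      + E.koopman (deriv (deriv φ) 0)) 0 := by
    have h1 := E.hasDerivAt_weight 0
    have h2 := ((h1.const_mul E.logDT).mul
      (E.koopman.hasFDerivAt.comp_hasDerivAt 0 hφd.self_of_nhds)).add
      (h1.mul (E.koopman.hasFDerivAt.comp_hasDerivAt 0 hφd2))
    refine h2.congr_deriv ?_
    simp only [Function.comp_apply, weight_zero, hφ0, hk1, mul_one, one_mul, ← hψ]
    ring
  -- the normalisation makes the derivatives of the eigenfunctions centred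
  have hmean : ∀ᶠ q in 𝓝 (0 : ℝ), mean μ (deriv φ q) = 0 := by
    filter_upwards [hφe.eventually_nhds, hφd] with q hq hd
    have h1 : HasDerivAt (fun q => mean μ (φ q)) (mean μ (deriv φ q)) q :=
      (mean μ).hasFDerivAt.comp_hasDerivAt q hd
    have h2 : (fun q => mean μ (φ q)) =ᶠ[𝓝 q] fun _ => 1 := hq.mono fun s hs => hs.1
    exact h1.unique ((hasDerivAt_const q (1 : ℝ)).congr_of_eventuallyEq h2)
  have hmean2 : mean μ (deriv (deriv φ) 0) = 0 := by
    have h1 : HasDerivAt (fun q => mean μ (deriv φ q)) (mean μ (deriv (deriv φ) 0)) 0 :=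
      (mean μ).hasFDerivAt.comp_hasDerivAt 0 hφd2
    exact h1.unique ((hasDerivAt_const 0 (0 : ℝ)).congr_of_eventuallyEq hmean)
  have hlyap' : mean μ (E.avg E.logDT) = 0 := hlyap
  have hr1 : mean μ (E.avg (G 0)) = 0 := by
    rw [hG0, map_add, avg_koopman, map_add, hlyap', hμ.mean_transfer, hmean.self_of_nhds, add_zero]
  have hpoisson : ψ - E.transfer 0 ψ = E.avg E.logDT := by
    have h1 : HasDerivAt (fun q => r q • φ q) (r 0 • ψ + mean μ (E.avg (G 0)) • φ 0) 0 :=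
      hrd.self_of_nhds.smul hφd.self_of_nhds
    have h2 : (fun q => E.transfer q (φ q)) =ᶠ[𝓝 0] fun q => r q • φ q :=
      hφe.mono fun q hq => hq.2.2.2
    have h3 := hGd.self_of_nhds.unique (h1.congr_of_eventuallyEq h2)
    rw [hr1, zero_smul, add_zero, hr0, one_smul, hG0, map_add, avg_koopman] at h3
    exact sub_eq_of_eq_add h3.symm
  have hr2 : HasDerivAt (fun q => mean μ (E.avg (G q))) (mean μ (E.incrementVar ψ)) 0 := by
    have h1 : HasDerivAt (fun q => mean μ (E.avg (G q))) _ 0 :=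
      ((mean μ) ∘L E.avg).hasFDerivAt.comp_hasDerivAt 0 hG2
    refine h1.congr_deriv ?_
    have h2 : (E.logDT + E.koopman ψ) * (E.logDT + E.koopman ψ) =
        E.logDT * E.logDT + 2 * (E.logDT * E.koopman ψ) + E.koopman (ψ * ψ) := by
      have : E.koopman (ψ * ψ) = E.koopman ψ * E.koopman ψ := rfl
      rw [this]
      ring
    change mean μ (E.avg _) = _
    rw [incrementVar, h2]
    simp only [map_add, map_sub, avg_koopman, hμ.mean_transfer, hmean2]
    ring
  have hV : E.V = mean μ (E.incrementVar ψ) := by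
    have h1 : deriv E.momentLyapunov =ᶠ[𝓝 0] fun q => mean μ (E.avg (G q)) / r q := by
      filter_upwards [hlogr.eventually_nhds, hrd, hφe] with q h1 h2 h3
      exact ((h2.log h3.2.2.1.ne').congr_of_eventuallyEq h1).deriv
    rw [V, h1.deriv_eq, (hr2.fun_div hrd.self_of_nhds (by rw [hr0]; exact one_ne_zero)).deriv, hr0,
      hr1]
    simp
  refine ⟨?_, ψ, hpoisson, hV.symm, fun hVpos => ?_⟩
  · exact (hrC.log (by rw [hr0]; exact one_ne_zero)).congr_of_eventuallyEq hlogr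
  -- the derivative of the eigenvalue is positive on an interval to the right of the origin
  have hpos : ∀ᶠ q in 𝓝[>] (0 : ℝ), 0 < mean μ (E.avg (G q)) := by
    rw [hV] at hVpos
    have h1 := (hasDerivAt_iff_tendsto_slope.1 hr2).eventually (lt_mem_nhds hVpos)
    have h2 : ∀ᶠ q in 𝓝[>] (0 : ℝ), 0 < slope (fun q => mean μ (E.avg (G q))) 0 q :=
      h1.filter_mono (nhdsWithin_mono _ fun q hq => ne_of_gt hq)
    filter_upwards [h2, self_mem_nhdsWithin] with q h3 h4
    rw [slope_def_field, hr1, sub_zero, sub_zero] at h3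
    have h5 : (0 : ℝ) < q := h4
    exact (div_pos_iff_of_pos_right h5).1 h3
  obtain ⟨η, hη, hη'⟩ := Metric.eventually_nhds_iff.1 (hrd.and hφe)
  obtain ⟨η₂, hη₂, hη₂'⟩ := mem_nhdsGT_iff_exists_Ioo_subset.1 hpos
  set s := min (min (η / 2) (η₂ / 2)) (1 / 2) with hs
  have hη₂0 : (0 : ℝ) < η₂ := hη₂
  have hs0 : 0 < s := by positivity
  have hsη : s < η := by
    have : s ≤ η / 2 := (min_le_left _ _).trans (min_le_left _ _)
    linarith
  have hsη₂ : s < η₂ := by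
    have : s ≤ η₂ / 2 := (min_le_left _ _).trans (min_le_right _ _)
    linarith
  have hs1 : s < 1 := by
    have : s ≤ 1 / 2 := min_le_right _ _
    linarith
  have hball : ∀ q ∈ Set.Icc 0 s, dist q 0 < η := fun q hq => by
    rw [Real.dist_0_eq_abs, abs_of_nonneg hq.1]
    exact hq.2.trans_lt hsη
  have hmono : StrictMonoOn r (Set.Icc 0 s) := by
    refine strictMonoOn_of_deriv_pos (convex_Icc _ _) (fun q hq =>
      (hη' (hball q hq)).1.continuousAt.continuousWithinAt) fun q hq => ?_
    rw [interior_Icc] at hq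
    rw [(hη' (hball q (Set.Ioo_subset_Icc_self hq))).1.deriv]
    exact hη₂' ⟨hq.1, hq.2.trans hsη₂⟩
  have h1s : 1 < r s := by
    rw [← hr0]
    exact hmono (Set.left_mem_Icc.2 hs0.le) (Set.right_mem_Icc.2 hs0.le) hs0
  have hsφ := (hη' (hball s (Set.right_mem_Icc.2 hs0.le))).2
  exact ⟨s, r s, hs0, hs1, h1s, φ s, hsφ.2.1, hsφ.2.2.2⟩

/-! ### Positivity of the asymptotic variance -/

/-- If the variance vanished, then `ln DT` would be the coboundary `ψ - ψ ∘ T`, and the multiplier of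
every periodic orbit would be one. -/
theorem IsStationary.mean_incrementVar_pos (hμ : E.IsStationary μ) (hmin : E.Minorising)
    (hper : E.HasAttractingPeriodicOrbit) {ψ : C(UnitAddCircle, ℝ)}
    (hψ : ψ - E.transfer 0 ψ = E.avg E.logDT) : 0 < mean μ (E.incrementVar ψ) := by
  have h0 : 0 ≤ E.incrementVar ψ := fun x => by
    change (0 : ℝ) ≤ E.incrementVar ψ x
    rw [incrementVar_apply hψ]
    exact integral_nonneg fun a => sq_nonneg _
  refine lt_of_le_of_ne (mean_nonneg h0) fun hmean => ?_
  have hzero : ∀ y, E.incrementVar ψ y = 0 := by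
    by_contra! h
    obtain ⟨y, hy⟩ := h
    have hy' : 0 < E.incrementVar ψ y := lt_of_le_of_ne (h0 y) (Ne.symm hy)
    obtain ⟨k, -, hk⟩ := hmin
    have hpos : ∀ x, 0 < (E.transfer 0 ^ k) (E.incrementVar ψ) x := by
      intro x
      obtain ⟨ω, hω, hx⟩ := hk x y
      exact E.transfer_pow_pos 0 k h0 hω (by rwa [hx])
    obtain ⟨p, -, hp⟩ := isCompact_univ.exists_isMinOn (Set.univ_nonempty (α := UnitAddCircle))
      ((E.transfer 0 ^ k) (E.incrementVar ψ)).continuous.continuousOn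
    have h1 : mean μ ((E.transfer 0 ^ k) (E.incrementVar ψ) p • 1) ≤
        mean μ ((E.transfer 0 ^ k) (E.incrementVar ψ)) := mean_mono fun x => by
      simpa using isMinOn_iff.1 hp x (Set.mem_univ _)
    rw [hμ.mean_transfer_pow, ← hmean, map_smul, mean_one, smul_eq_mul, mul_one] at h1
    exact absurd h1 (not_le.2 (hpos p))
  have hcob : ∀ x, E.logDT x = ψ x - ψ (E.T x) := by
    intro x
    by_contra hne
    have hcont : Continuous fun a : ℝ =>
        (E.logDT (x + (a : UnitAddCircle)) + ψ (E.Tt a x) - ψ x) ^ 2 :=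
      (((E.logDT.continuous.comp (continuous_add_coe x)).add
        ((ψ.continuous.comp E.continuous_T).comp (continuous_add_coe x))).sub
          continuous_const).pow 2
    have h1 := E.integral_noise_pos hcont (fun a => sq_nonneg _) (c := 0)
      ⟨by linarith [E.ϑ_pos], E.ϑ_pos.le⟩ ?_
    · rw [← incrementVar_apply hψ, hzero] at h1
      exact lt_irrefl _ h1
    · have h2 : E.logDT x + ψ (E.T x) - ψ x ≠ 0 := fun h => hne (by linarith)
      simp only [Tt, AddCircle.coe_zero, add_zero]
      positivity
  obtain ⟨p, x, -, hpx, hlt⟩ := hper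
  have hsum : ∀ n, ∏ i ∈ Finset.range n, E.DT (E.T^[i] x) = Real.exp (ψ x - ψ (E.T^[n] x)) := by
    intro n
    induction n with
    | zero => simp
    | succ n ih =>
      have h1 := hcob (E.T^[n] x)
      rw [logDT_apply] at h1
      rw [Finset.prod_range_succ, ih, ← Real.exp_log (E.DT_pos (E.T^[n] x)), h1, ← Real.exp_add,
        Function.iterate_succ_apply']
      congr 1
      ring
  rw [hsum p, hpx, sub_self, Real.exp_zero, abs_one] at hlt
  exact lt_irrefl _ hlt

end Stationary

/-! ### Chains driven by independent noise: drift criteria for exit times -/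

/-- The chain started at `z` which applies the map `S (ω n)` at time `n`. -/
def walk {Z : Type*} (S : ℝ → Z → Z) (ω : ℕ → ℝ) : ℕ → Z → Z
  | 0, z => z
  | n + 1, z => S (ω n) (walk S ω n z)

theorem walk_consSeq {Z : Type*} (S : ℝ → Z → Z) (a : ℝ) (ω : ℕ → ℝ) (n : ℕ) (z : Z) :
    walk S (consSeq a ω) (n + 1) z = walk S ω n (S a z) := by
  induction n with
  | zero => rfl
  | succ n ih => rw [walk, ih, walk, consSeq_succ]

/-- The event that the chain stays in `D` at all times before `n`. -/
def stayEvent {Z : Type*} (S : ℝ → Z → Z) (D : Set Z) (n : ℕ) (z : Z) : Set (ℕ → ℝ) :=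
  {ω | ∀ i < n, walk S ω i z ∈ D}

/-- The event that the chain visits `B` before time `n`, having stayed in `D` until then. -/
def hitEvent {Z : Type*} (S : ℝ → Z → Z) (D B : Set Z) (n : ℕ) (z : Z) : Set (ℕ → ℝ) :=
  {ω | ∃ i < n, walk S ω i z ∈ B ∧ ∀ j < i, walk S ω j z ∈ D}

theorem consSeq_mem_stayEvent {Z : Type*} {S : ℝ → Z → Z} {D : Set Z} {z : Z} (hz : z ∈ D) (n : ℕ)
    (a : ℝ) (ω : ℕ → ℝ) :
    consSeq a ω ∈ stayEvent S D (n + 1) z ↔ ω ∈ stayEvent S D n (S a z) := by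
  constructor
  · intro h i hi
    have := h (i + 1) (by omega)
    rwa [walk_consSeq] at this
  · intro h i hi
    cases i with
    | zero => exact hz
    | succ i =>
      rw [walk_consSeq]
      exact h i (by omega)

theorem stayEvent_of_notMem {Z : Type*} {S : ℝ → Z → Z} {D : Set Z} {z : Z} (hz : z ∉ D) (n : ℕ) :
    stayEvent S D (n + 1) z = ∅ :=
  Set.eq_empty_of_forall_notMem fun _ h => hz (h 0 n.succ_pos)

theorem consSeq_mem_hitEvent {Z : Type*} {S : ℝ → Z → Z} {D B : Set Z} {z : Z} (hz : z ∈ D)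
    (hzB : z ∉ B) (n : ℕ) (a : ℝ) (ω : ℕ → ℝ) :
    consSeq a ω ∈ hitEvent S D B (n + 1) z ↔ ω ∈ hitEvent S D B n (S a z) := by
  constructor
  · rintro ⟨i, hi, hB, hD⟩
    cases i with
    | zero => exact absurd hB hzB
    | succ i =>
      rw [walk_consSeq] at hB
      refine ⟨i, by omega, hB, fun j hj => ?_⟩
      have := hD (j + 1) (by omega)
      rwa [walk_consSeq] at this
  · rintro ⟨i, hi, hB, hD⟩
    refine ⟨i + 1, by omega, by rwa [walk_consSeq], fun j hj => ?_⟩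
    cases j with
    | zero => exact hz
    | succ j =>
      rw [walk_consSeq]
      exact hD j (by omega)

theorem hitEvent_of_notMem {Z : Type*} {S : ℝ → Z → Z} {D B : Set Z} {z : Z} (hz : z ∉ D)
    (hzB : z ∉ B) (n : ℕ) : hitEvent S D B n z = ∅ := by
  refine Set.eq_empty_of_forall_notMem ?_
  rintro ω ⟨i, -, hB, hD⟩
  cases i with
  | zero => exact hzB hB
  | succ i => exact hz (hD 0 i.succ_pos)

theorem measurable_walk {Z : Type*} [MeasurableSpace Z] {S : ℝ → Z → Z}
    (hS : Measurable fun p : ℝ × Z => S p.1 p.2) (n : ℕ) (z : Z) :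
    Measurable fun ω : ℕ → ℝ => walk S ω n z := by
  induction n with
  | zero => exact measurable_const
  | succ n ih => exact hS.comp ((measurable_pi_apply n).prodMk ih)

theorem measurableSet_stayEvent {Z : Type*} [MeasurableSpace Z] {S : ℝ → Z → Z}
    (hS : Measurable fun p : ℝ × Z => S p.1 p.2) {D : Set Z} (hD : MeasurableSet D) (n : ℕ) (z : Z) :
    MeasurableSet (stayEvent S D n z) := by
  have h : stayEvent S D n z = ⋂ i, ⋂ (_ : i < n), (fun ω => walk S ω i z) ⁻¹' D := by
    ext ω
    simp [stayEvent]
  rw [h]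
  exact .iInter fun i => .iInter fun _ => measurable_walk hS i z hD

theorem measurableSet_hitEvent {Z : Type*} [MeasurableSpace Z] {S : ℝ → Z → Z}
    (hS : Measurable fun p : ℝ × Z => S p.1 p.2) {D B : Set Z} (hD : MeasurableSet D)
    (hB : MeasurableSet B) (n : ℕ) (z : Z) : MeasurableSet (hitEvent S D B n z) := by
  have h : hitEvent S D B n z = ⋃ i, ⋃ (_ : i < n), ((fun ω => walk S ω i z) ⁻¹' B ∩
      stayEvent S D i z) := by
    ext ω
    simp [hitEvent, stayEvent, and_left_comm]
  rw [h]
  exact .iUnion fun i => .iUnion fun _ =>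
    (measurable_walk hS i z hB).inter (measurableSet_stayEvent hS hD i z)

/-- Conditioning an event on the first noise variable. -/
theorem integrable_and_measureReal_eq_integral {A : Set (ℕ → ℝ)} (hA : MeasurableSet A)
    {A' : ℝ → Set (ℕ → ℝ)} (h : ∀ a ω, consSeq a ω ∈ A ↔ ω ∈ A' a) :
    Integrable (fun a => E.ℙ.real (A' a)) E.noise ∧
      E.ℙ.real A = ∫ a, E.ℙ.real (A' a) ∂E.noise := by
  have hmp := E.measurePreserving_consSeq
  have hA' : MeasurableSet ((fun p : ℝ × (ℕ → ℝ) => consSeq p.1 p.2) ⁻¹' A) := hmp.measurable hA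
  have hsec : ∀ a, Prod.mk a ⁻¹' ((fun p : ℝ × (ℕ → ℝ) => consSeq p.1 p.2) ⁻¹' A) = A' a :=
    fun a => Set.ext fun ω => h a ω
  have hmeas : Measurable fun a => E.ℙ (A' a) := by
    have := measurable_measure_prodMk_left (ν := E.ℙ) hA'
    simpa only [hsec] using this
  constructor
  · refine E.integrable_noise hmeas.ennreal_toReal (C := 1) fun a => ?_
    rw [abs_of_nonneg measureReal_nonneg]
    exact measureReal_le_one
  · have h1 : E.ℙ A = ∫⁻ a, E.ℙ (A' a) ∂E.noise := by
      rw [← hmp.measure_preimage hA.nullMeasurableSet, Measure.prod_apply hA']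
      simp only [hsec]
    rw [measureReal_def, h1, ← integral_toReal hmeas.aemeasurable
      (Eventually.of_forall fun a => measure_lt_top _ _)]
    rfl

section Drift

variable {E} {Z : Type*} {S : ℝ → Z → Z} {D G : Set Z} {U : Z → ℝ}

theorem measureReal_stayEvent_zero (z : Z) : E.ℙ.real (stayEvent S D 0 z) = 1 := by
  have : stayEvent S D 0 z = Set.univ := Set.eq_univ_of_forall fun ω i hi => absurd hi (by omega)
  rw [this, probReal_univ]

/-- First-step analysis of the truncated mean exit time `∑_{j < n} ℙ (τ > j)`. -/
theorem sum_stayEvent_succ [MeasurableSpace Z] (hS : Measurable fun p : ℝ × Z => S p.1 p.2)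
    (hD : MeasurableSet D)
    (n : ℕ) {z : Z} (hz : z ∈ D) :
    Integrable (fun a => ∑ j ∈ Finset.range n, E.ℙ.real (stayEvent S D (j + 1) (S a z))) E.noise ∧
    ∑ j ∈ Finset.range (n + 1), E.ℙ.real (stayEvent S D (j + 1) z) =
      1 + ∫ a, ∑ j ∈ Finset.range n, E.ℙ.real (stayEvent S D (j + 1) (S a z)) ∂E.noise := by
  have key : ∀ j, Integrable (fun a => E.ℙ.real (stayEvent S D j (S a z))) E.noise ∧
      E.ℙ.real (stayEvent S D (j + 1) z) = ∫ a, E.ℙ.real (stayEvent S D j (S a z)) ∂E.noise :=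
    fun j => E.integrable_and_measureReal_eq_integral (measurableSet_stayEvent hS hD (j + 1) z)
      (consSeq_mem_stayEvent hz j)
  refine ⟨integrable_finsetSum _ fun j _ => (key (j + 1)).1, ?_⟩
  rw [Finset.sum_congr rfl fun j _ => (key j).2, ← integral_finsetSum _ fun j _ => (key j).1]
  have h : ∀ a, ∑ j ∈ Finset.range (n + 1), E.ℙ.real (stayEvent S D j (S a z)) =
      1 + ∑ j ∈ Finset.range n, E.ℙ.real (stayEvent S D (j + 1) (S a z)) := fun a => by
    rw [Finset.sum_range_succ', measureReal_stayEvent_zero, add_comm]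
  simp only [h]
  rw [integral_add (integrable_const _) (integrable_finsetSum _ fun j _ => (key (j + 1)).1)]
  simp

theorem sum_stayEvent_of_notMem (n : ℕ) {z : Z} (hz : z ∉ D) :
    ∑ j ∈ Finset.range n, E.ℙ.real (stayEvent S D (j + 1) z) = 0 :=
  Finset.sum_eq_zero fun j _ => by rw [stayEvent_of_notMem hz, measureReal_empty]

/-- A nonnegative function decreasing on average by at least `κ` per step bounds the mean exit
time. -/
theorem sum_stayEvent_le [MeasurableSpace Z] (hS : Measurable fun p : ℝ × Z => S p.1 p.2)
    (hD : MeasurableSet D)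
    (hDG : ∀ z ∈ D, ∀ a, S a z ∈ G)
    (hU : ∀ z ∈ D, Integrable (fun a => U (S a z)) E.noise) {κ : ℝ}
    (hU0 : ∀ z ∈ G, 0 ≤ U z) (hstep : ∀ z ∈ D, κ + ∫ a, U (S a z) ∂E.noise ≤ U z)
    (n : ℕ) {z : Z} (hz : z ∈ G) :
    κ * ∑ j ∈ Finset.range n, E.ℙ.real (stayEvent S D (j + 1) z) ≤ U z := by
  induction n generalizing z with
  | zero => simpa using hU0 z hz
  | succ n ih =>
    by_cases hzD : z ∈ D
    · obtain ⟨hint, heq⟩ := sum_stayEvent_succ (E := E) hS hD n hzD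
      rw [heq, mul_add, mul_one, ← integral_const_mul]
      refine le_trans ?_ (hstep z hzD)
      gcongr
      · exact hint.const_mul κ
      · exact hU z hzD
      · exact fun a => ih (hDG z hzD a)
    · rw [sum_stayEvent_of_notMem _ hzD, mul_zero]
      exact hU0 z hz

/-- A function which is nonpositive after the exit and decreases on average by at most `κ` per step
bounds the mean exit time from below. -/
theorem le_sum_stayEvent [MeasurableSpace Z] (hS : Measurable fun p : ℝ × Z => S p.1 p.2)
    (hD : MeasurableSet D)
    (hDG : ∀ z ∈ D, ∀ a, S a z ∈ G)
    (hU : ∀ z ∈ D, Integrable (fun a => U (S a z)) E.noise) {κ C : ℝ}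
    (hU0 : ∀ z ∈ G, z ∉ D → U z ≤ 0) (hC0 : 0 ≤ C) (hC : ∀ z ∈ G, U z ≤ C)
    (hstep : ∀ z ∈ D, U z ≤ κ + ∫ a, U (S a z) ∂E.noise) (n : ℕ) {z : Z} (hz : z ∈ G) :
    U z ≤ κ * ∑ j ∈ Finset.range n, E.ℙ.real (stayEvent S D (j + 1) z) +
      C * E.ℙ.real (stayEvent S D n z) := by
  induction n generalizing z with
  | zero => simpa [measureReal_stayEvent_zero] using hC z hz
  | succ n ih =>
    by_cases hzD : z ∈ D
    · obtain ⟨hint, heq⟩ := sum_stayEvent_succ (E := E) hS hD n hzD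
      obtain ⟨hint2, heq2⟩ := E.integrable_and_measureReal_eq_integral
        (measurableSet_stayEvent hS hD (n + 1) z) (consSeq_mem_stayEvent hzD n)
      have h1 : ∫ a, U (S a z) ∂E.noise ≤
          ∫ a, (κ * ∑ j ∈ Finset.range n, E.ℙ.real (stayEvent S D (j + 1) (S a z)) +
            C * E.ℙ.real (stayEvent S D n (S a z))) ∂E.noise :=
        integral_mono (hU z hzD) ((hint.const_mul κ).add (hint2.const_mul C))
          fun a => ih (hDG z hzD a)
      rw [integral_add (hint.const_mul κ) (hint2.const_mul C), integral_const_mul,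
        integral_const_mul, ← heq2] at h1
      rw [heq]
      linarith [hstep z hzD]
    · rw [sum_stayEvent_of_notMem _ hzD, mul_zero, zero_add]
      exact (hU0 z hz hzD).trans (mul_nonneg hC0 measureReal_nonneg)

/-- A nonnegative superharmonic function which is at least one on `B` bounds the probability of
leaving `D` through `B`. -/
theorem measureReal_hitEvent_le [MeasurableSpace Z] {B : Set Z}
    (hS : Measurable fun p : ℝ × Z => S p.1 p.2) (hD : MeasurableSet D) (hB : MeasurableSet B)
    (hDG : ∀ z ∈ D, ∀ a, S a z ∈ G)
    (hU : ∀ z ∈ D, Integrable (fun a => U (S a z)) E.noise)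
    (hU0 : ∀ z ∈ G, 0 ≤ U z) (hU1 : ∀ z ∈ G, z ∈ B → 1 ≤ U z)
    (hstep : ∀ z ∈ D, ∫ a, U (S a z) ∂E.noise ≤ U z) (n : ℕ) {z : Z} (hz : z ∈ G) :
    E.ℙ.real (hitEvent S D B n z) ≤ U z := by
  induction n generalizing z with
  | zero =>
    have : hitEvent S D B 0 z = ∅ := Set.eq_empty_of_forall_notMem fun ω ⟨i, hi, _⟩ => by omega
    rw [this, measureReal_empty]
    exact hU0 z hz
  | succ n ih =>
    by_cases hzB : z ∈ B
    · exact measureReal_le_one.trans (hU1 z hz hzB)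
    by_cases hzD : z ∈ D
    · obtain ⟨hint, heq⟩ := E.integrable_and_measureReal_eq_integral
        (measurableSet_hitEvent hS hD hB (n + 1) z) (consSeq_mem_hitEvent hzD hzB n)
      rw [heq]
      exact (integral_mono hint (hU z hzD) fun a => ih (hDG z hzD a)).trans (hstep z hzD)
    · rw [hitEvent_of_notMem hzD hzB, measureReal_empty]
      exact hU0 z hz

end Drift

/-! ### The two-point motion near the diagonal -/

theorem exists_lipschitz_deriv : ∃ L : ℝ, 0 ≤ L ∧
    ∀ u v, |deriv E.F u - deriv E.F v| ≤ L * |u - v| := by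
  have hper : Function.Periodic (deriv (deriv E.F)) 1 := by
    intro x
    have h : (fun y => deriv E.F (y + 1)) = deriv E.F := funext E.periodic_deriv_F
    rw [← deriv_comp_add_const, h]
  have hF' : ContDiff ℝ 1 (deriv E.F) := by
    have h : ContDiff ℝ (1 + 1) E.F := by
      rw [one_add_one_eq_two]
      exact E.contDiff_F
    exact h.deriv'
  let G : C(UnitAddCircle, ℝ) :=
    ⟨hper.lift, continuous_quot_lift _ (hF'.continuous_deriv (by norm_num))⟩
  refine ⟨‖G‖, norm_nonneg _, fun u v => ?_⟩
  exact Convex.norm_image_sub_le_of_norm_deriv_le (s := Set.univ)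
    (fun x _ => (hF'.differentiable (by norm_num)) x)
    (fun x _ => G.norm_coe_le_norm (x : UnitAddCircle)) convex_univ (Set.mem_univ _) (Set.mem_univ _)

theorem exists_deriv_mul_eq_sub (u t : ℝ) :
    ∃ ζ, |ζ - u| ≤ |t| ∧ E.F (u + t) - E.F u = deriv E.F ζ * t := by
  have hd : Differentiable ℝ E.F := E.contDiff_F.differentiable (by norm_num)
  rcases lt_trichotomy t 0 with ht | rfl | ht
  · obtain ⟨ζ, hζ, h⟩ := exists_deriv_eq_slope E.F (show u + t < u by linarith)
      hd.continuous.continuousOn hd.differentiableOn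
    refine ⟨ζ, ?_, ?_⟩
    · rw [abs_of_neg ht, abs_le]
      constructor <;> linarith [hζ.1, hζ.2]
    · rw [h, eq_comm, div_mul_eq_mul_div, div_eq_iff (by linarith)]
      ring
  · exact ⟨u, by simp, by simp⟩
  · obtain ⟨ζ, hζ, h⟩ := exists_deriv_eq_slope E.F (show u < u + t by linarith)
      hd.continuous.continuousOn hd.differentiableOn
    refine ⟨ζ, ?_, ?_⟩
    · rw [abs_of_pos ht, abs_le]
      constructor <;> linarith [hζ.1, hζ.2]
    · rw [h, eq_comm, div_mul_eq_mul_div, div_eq_iff (by linarith)]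
      ring

theorem abs_log_sub_log_le {b x y : ℝ} (hb : 0 < b) (hx : b ≤ x) (hy : b ≤ y) :
    |Real.log x - Real.log y| ≤ |x - y| / b := by
  have key : ∀ x y : ℝ, b ≤ x → b ≤ y → Real.log x - Real.log y ≤ |x - y| / b := by
    intro x y hx hy
    have hx0 := hb.trans_le hx
    have hy0 := hb.trans_le hy
    rw [← Real.log_div hx0.ne' hy0.ne']
    refine (Real.log_le_sub_one_of_pos (by positivity)).trans ?_
    rw [div_sub_one hy0.ne']
    calc (x - y) / y ≤ |x - y| / y := by gcongr; exact le_abs_self _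
      _ ≤ |x - y| / b := by gcongr
  rw [abs_le]
  have h1 := key y x hy hx
  rw [abs_sub_comm] at h1
  exact ⟨by linarith, key x y hx hy⟩

/-- One step of the two-point motion. -/
def pairStep (a : ℝ) (z : UnitAddCircle × UnitAddCircle) : UnitAddCircle × UnitAddCircle :=
  (E.Tt a z.1, E.Tt a z.2)

/-- Logarithm of the distance of two points. -/
def logDist (z : UnitAddCircle × UnitAddCircle) : ℝ := Real.log (dist z.1 z.2)

/-- Near the diagonal the logarithmic distance changes in one step by `ln DT`, up to an error
proportional to the distance. -/
theorem exists_logDist_pairStep_bound : ∃ R C : ℝ, 0 < R ∧ 0 ≤ C ∧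
    ∀ z : UnitAddCircle × UnitAddCircle, 0 < dist z.1 z.2 → dist z.1 z.2 < R → ∀ a,
      0 < dist (E.pairStep a z).1 (E.pairStep a z).2 ∧
      |logDist (E.pairStep a z) - logDist z - E.logDT (z.1 + (a : UnitAddCircle))| ≤
        C * dist z.1 z.2 := by
  obtain ⟨a₁, a₂, h1, h12, hb⟩ := E.deriv_bounds
  obtain ⟨L, hL, hLip⟩ := E.exists_lipschitz_deriv
  have h2 : 0 < a₂ := h1.trans h12
  refine ⟨1 / (2 * a₂), L / a₁, by positivity, by positivity, ?_⟩
  rintro ⟨x, y⟩ hpos hlt a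
  simp only [pairStep, logDist] at hpos hlt ⊢
  obtain ⟨u, hu⟩ : ∃ u : ℝ, (u : UnitAddCircle) = x + (a : UnitAddCircle) :=
    QuotientAddGroup.mk_surjective _
  obtain ⟨t, ht, htn⟩ := exists_coe_eq_abs_eq_norm (y - x)
  have hdist : dist x y = |t| := by rw [htn, dist_comm, dist_eq_norm]
  have hy : y + (a : UnitAddCircle) = ((u + t : ℝ) : UnitAddCircle) := by
    rw [AddCircle.coe_add, hu, ht]
    abel
  obtain ⟨ζ, hζ, hζe⟩ := E.exists_deriv_mul_eq_sub u t
  rw [hdist] at hpos hlt ⊢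
  have hbound : |deriv E.F ζ * t| ≤ 1 / 2 := by
    rw [abs_mul, abs_of_pos (h1.trans (hb ζ).1)]
    calc deriv E.F ζ * |t| ≤ a₂ * (1 / (2 * a₂)) := by
          gcongr
          exact (hb ζ).2.le
      _ = 1 / 2 := by field_simp
  have hdist' : dist (E.Tt a x) (E.Tt a y) = deriv E.F ζ * |t| := by
    rw [Tt, Tt, ← hu, hy, T_coe, T_coe, dist_comm, dist_eq_norm, ← AddCircle.coe_sub, hζe,
      (AddCircle.norm_coe_eq_abs_iff 1 one_ne_zero).2 (by simpa using hbound), abs_mul,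
      abs_of_pos (h1.trans (hb ζ).1)]
  have hFζ : 0 < deriv E.F ζ := h1.trans (hb ζ).1
  rw [hdist']
  refine ⟨by positivity, ?_⟩
  rw [Real.log_mul hFζ.ne' hpos.ne', logDT_apply, ← hu, DT_coe, add_sub_cancel_right]
  refine (abs_log_sub_log_le h1 (hb ζ).1.le (hb u).1.le).trans ?_
  rw [div_mul_eq_mul_div]
  gcongr
  exact (hLip ζ u).trans (by gcongr)

theorem measurable_logDist : Measurable logDist :=
  Real.measurable_log.comp continuous_dist.measurable

theorem continuous_pairStep :
    Continuous fun p : ℝ × (UnitAddCircle × UnitAddCircle) => E.pairStep p.1 p.2 :=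
  (E.continuous_Tt.comp (continuous_fst.prodMk continuous_snd.fst)).prodMk
    (E.continuous_Tt.comp (continuous_fst.prodMk continuous_snd.snd))

theorem measurable_pairStep_left (z : UnitAddCircle × UnitAddCircle) :
    Measurable fun a => E.pairStep a z :=
  E.continuous_pairStep.measurable.comp (measurable_id.prodMk measurable_const)

theorem walk_pairStep (ω : ℕ → ℝ) (n : ℕ) (x y : UnitAddCircle) :
    walk E.pairStep ω n (x, y) = (E.iter ω n x, E.iter ω n y) := by
  induction n with
  | zero => rfl
  | succ n ih => rw [walk, ih]; rfl

/-! ### Drift estimates for the two-point motion -/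

section Drift

variable {E} {C : ℝ}

/-- The error in the linearisation of the logarithmic distance in one step. -/
def stepError (E : RandomCircleMap) (z : UnitAddCircle × UnitAddCircle) (a : ℝ) : ℝ :=
  logDist (E.pairStep a z) - logDist z - E.logDT (z.1 + (a : UnitAddCircle))

theorem measurable_stepError (z : UnitAddCircle × UnitAddCircle) :
    Measurable (E.stepError z) :=
  ((measurable_logDist.comp (E.measurable_pairStep_left z)).sub_const _).sub
    (E.logDT.continuous.comp (continuous_add_coe z.1)).measurable

theorem integral_stepError_le {z : UnitAddCircle × UnitAddCircle}
    (he : ∀ a, |E.stepError z a| ≤ C) : |∫ a, E.stepError z a ∂E.noise| ≤ C := by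
  have := norm_integral_le_of_norm_le_const (μ := E.noise) (f := E.stepError z) (C := C)
    (Eventually.of_forall he)
  simpa using this

/-- The increment of the corrected logarithmic distance `N = ln d + ψ` is a centred variable with
conditional second moment `incrementVar ψ`, up to errors proportional to the distance. -/
theorem drift_corrected_logDist {ψ : C(UnitAddCircle, ℝ)}
    (hψ : ψ - E.transfer 0 ψ = E.avg E.logDT) {z : UnitAddCircle × UnitAddCircle} {η : ℝ}
    (he : ∀ a, |E.stepError z a| ≤ η) :
    Integrable (fun a => logDist (E.pairStep a z) + ψ (E.pairStep a z).1) E.noise ∧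
    Integrable (fun a => (logDist (E.pairStep a z) + ψ (E.pairStep a z).1) ^ 2) E.noise ∧
    |(∫ a, (logDist (E.pairStep a z) + ψ (E.pairStep a z).1) ∂E.noise) - (logDist z + ψ z.1)| ≤ η ∧
    |(∫ a, (logDist (E.pairStep a z) + ψ (E.pairStep a z).1) ^ 2 ∂E.noise) -
        (logDist z + ψ z.1) ^ 2 - E.incrementVar ψ z.1| ≤
      (2 * |logDist z + ψ z.1| + 2 * (‖E.logDT‖ + 2 * ‖ψ‖) + η) * η := by
  set N := logDist z + ψ z.1 with hN
  set e := E.stepError z with he_def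
  set ξ : ℝ → ℝ := fun a => E.logDT (z.1 + (a : UnitAddCircle)) + ψ (E.Tt a z.1) - ψ z.1 with hξ
  have hη : 0 ≤ η := (abs_nonneg _).trans (he 0)
  have hem : Measurable e := measurable_stepError z
  have hξm : Measurable ξ := by
    have h : Continuous ξ := ((E.logDT.continuous.comp (continuous_add_coe z.1)).add
      ((ψ.continuous.comp E.continuous_T).comp (continuous_add_coe z.1))).sub continuous_const
    exact h.measurable
  have hξB : ∀ a, |ξ a| ≤ ‖E.logDT‖ + 2 * ‖ψ‖ := by
    intro a
    have h1 := abs_le.1 (E.logDT.norm_coe_le_norm (z.1 + (a : UnitAddCircle)))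
    have h2 := abs_le.1 (ψ.norm_coe_le_norm (E.Tt a z.1))
    have h3 := abs_le.1 (ψ.norm_coe_le_norm z.1)
    rw [abs_le]
    constructor <;> simp only [hξ] <;> linarith [h1.1, h1.2, h2.1, h2.2, h3.1, h3.2]
  set B := ‖E.logDT‖ + 2 * ‖ψ‖ with hB
  have hB0 : 0 ≤ B := by positivity
  have hstep : ∀ a, logDist (E.pairStep a z) + ψ (E.pairStep a z).1 = N + ξ a + e a := by
    intro a
    simp only [hN, hξ, he_def, stepError, pairStep]
    ring
  have iξ : Integrable ξ E.noise := E.integrable_noise hξm hξB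
  have ie : Integrable e E.noise := E.integrable_noise hem he
  have iξ2 : Integrable (fun a => ξ a ^ 2) E.noise :=
    E.integrable_noise (hξm.pow_const 2) (C := B ^ 2) fun a => by
      rw [abs_pow]
      exact pow_le_pow_left₀ (abs_nonneg _) (hξB a) 2
  have herr : ∀ a, |2 * ξ a * e a + e a ^ 2| ≤ (2 * B + η) * η := by
    intro a
    have h1 : |2 * ξ a * e a + e a ^ 2| = |2 * ξ a + e a| * |e a| := by
      rw [← abs_mul]
      congr 1
      ring
    rw [h1]
    refine mul_le_mul ?_ (he a) (abs_nonneg _) (by positivity)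
    refine (abs_add_le _ _).trans ?_
    rw [abs_mul, abs_two]
    linarith [hξB a, he a]
  have ierr : Integrable (fun a => 2 * ξ a * e a + e a ^ 2) E.noise :=
    E.integrable_noise (((hξm.const_mul 2).mul hem).add (hem.pow_const 2)) herr
  have hξ0 : ∫ a, ξ a ∂E.noise = 0 := by
    have h1 : E.avg (E.logDT + E.koopman ψ) z.1 = ψ z.1 := by rw [avg_logDT_add_koopman hψ]
    rw [avg_apply] at h1
    have i1 := E.integrable_comp_add (E.logDT + E.koopman ψ) z.1
    have h2 : ∫ a, ((E.logDT + E.koopman ψ) (z.1 + (a : UnitAddCircle)) - ψ z.1) ∂E.noise = 0 := by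
      rw [integral_sub i1 (integrable_const _), h1]
      simp
    exact h2
  have hξ2 : ∫ a, ξ a ^ 2 ∂E.noise = E.incrementVar ψ z.1 := (incrementVar_apply hψ z.1).symm
  have ie0 : |∫ a, e a ∂E.noise| ≤ η := integral_stepError_le he
  have ierr0 : |∫ a, (2 * ξ a * e a + e a ^ 2) ∂E.noise| ≤ (2 * B + η) * η := by
    have := norm_integral_le_of_norm_le_const (μ := E.noise)
      (f := fun a => 2 * ξ a * e a + e a ^ 2) (Eventually.of_forall herr)
    simpa using this
  have hsq : ∀ a, (N + ξ a + e a) ^ 2 =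
      N ^ 2 + (2 * N * ξ a + (2 * N * e a + (ξ a ^ 2 + (2 * ξ a * e a + e a ^ 2)))) := fun a => by
    ring
  simp only [hstep]
  have j1 : Integrable (fun a => N + ξ a + e a) E.noise := ((integrable_const N).add iξ).add ie
  have k1 : Integrable (fun a => ξ a ^ 2 + (2 * ξ a * e a + e a ^ 2)) E.noise := iξ2.add ierr
  have k2 : Integrable (fun a => 2 * N * e a + (ξ a ^ 2 + (2 * ξ a * e a + e a ^ 2))) E.noise :=
    (ie.const_mul (2 * N)).add k1
  have k3 : Integrable (fun a => 2 * N * ξ a +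
      (2 * N * e a + (ξ a ^ 2 + (2 * ξ a * e a + e a ^ 2)))) E.noise :=
    (iξ.const_mul (2 * N)).add k2
  refine ⟨j1, ?_, ?_, ?_⟩
  · simp only [hsq]
    exact (integrable_const _).add k3
  · have h1 : ∫ a, (N + ξ a + e a) ∂E.noise = N + ∫ a, e a ∂E.noise := by
      have k4 : Integrable (fun a => N + ξ a) E.noise := (integrable_const N).add iξ
      rw [integral_add k4 ie, integral_add (integrable_const _) iξ, hξ0]
      simp
    rw [h1, add_sub_cancel_left]
    exact ie0
  · simp only [hsq]
    rw [integral_add (integrable_const _) k3, integral_add (iξ.const_mul _) k2,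
      integral_add (ie.const_mul _) k1, integral_add iξ2 ierr, integral_const_mul,
      integral_const_mul, hξ0, hξ2]
    simp only [integral_const, probReal_univ, one_smul]
    have h3 : N ^ 2 + (2 * N * 0 + (2 * N * ∫ a, e a ∂E.noise + (E.incrementVar ψ z.1 +
        ∫ a, (2 * ξ a * e a + e a ^ 2) ∂E.noise))) - N ^ 2 - E.incrementVar ψ z.1 =
        2 * N * (∫ a, e a ∂E.noise) + ∫ a, (2 * ξ a * e a + e a ^ 2) ∂E.noise := by ring
    rw [h3]
    refine (abs_add_le _ _).trans ?_
    rw [abs_mul, abs_mul, abs_two]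
    have h4 : 2 * |N| * |∫ a, e a ∂E.noise| ≤ 2 * |N| * η := by gcongr
    linarith

/-- The function `d ^ q φ(x)`, for `φ` a positive eigenfunction with eigenvalue `r > 1`, grows on
average by a factor close to `r` in each step near the diagonal. -/
theorem drift_dist_rpow {q r : ℝ} (hq : 0 < q) {φ : C(UnitAddCircle, ℝ)}
    (hφ0 : ∀ x, 0 ≤ φ x) (hφ : E.transfer q φ = r • φ)
    {z : UnitAddCircle × UnitAddCircle} {η : ℝ} (he : ∀ a, |E.stepError z a| ≤ η) :
    Integrable (fun a => Real.exp (q * logDist (E.pairStep a z)) * φ (E.pairStep a z).1) E.noise ∧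
    Real.exp (-(q * η)) * (r * (Real.exp (q * logDist z) * φ z.1)) ≤
      ∫ a, Real.exp (q * logDist (E.pairStep a z)) * φ (E.pairStep a z).1 ∂E.noise := by
  have hη : 0 ≤ η := (abs_nonneg _).trans (he 0)
  have hstep : ∀ a, logDist (E.pairStep a z) =
      logDist z + E.logDT (z.1 + (a : UnitAddCircle)) + E.stepError z a := fun a => by
    rw [stepError]
    ring
  have hint : Integrable
      (fun a => Real.exp (q * logDist (E.pairStep a z)) * φ (E.pairStep a z).1) E.noise := by
    refine E.integrable_noise (C := Real.exp (q * (|logDist z| + ‖E.logDT‖ + η)) * ‖φ‖) ?_ ?_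
    · exact ((measurable_logDist.comp (E.measurable_pairStep_left z)).const_mul q).exp.mul
        (φ.continuous.measurable.comp (measurable_fst.comp (E.measurable_pairStep_left z)))
    · intro a
      rw [abs_mul, Real.abs_exp]
      gcongr
      · rw [hstep]
        have h1 := abs_le.1 (E.logDT.norm_coe_le_norm (z.1 + (a : UnitAddCircle)))
        linarith [le_abs_self (logDist z), (abs_le.1 (he a)).2]
      · exact φ.norm_coe_le_norm _
  refine ⟨hint, ?_⟩
  have h1 : r * φ z.1 = ∫ a, E.DTt a z.1 ^ q * φ (E.Tt a z.1) ∂E.noise := by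
    rw [← transfer_apply, hφ]
    rfl
  have i1 : Integrable (fun a => E.DTt a z.1 ^ q * φ (E.Tt a z.1)) E.noise := by
    have := E.integrable_comp_add (E.weight q * E.koopman φ) z.1
    simpa [weight_apply, DTt, Tt] using this
  have h2 : Real.exp (-(q * η)) * (r * (Real.exp (q * logDist z) * φ z.1)) =
      ∫ a, Real.exp (-(q * η)) * Real.exp (q * logDist z) *
        (E.DTt a z.1 ^ q * φ (E.Tt a z.1)) ∂E.noise := by
    rw [integral_const_mul, ← h1]
    ring
  rw [h2]
  refine integral_mono (i1.const_mul _) hint fun a => ?_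
  have h3 : E.DTt a z.1 ^ q = Real.exp (q * E.logDT (z.1 + (a : UnitAddCircle))) := by
    rw [Real.rpow_def_of_pos (E.DTt_pos _ _), mul_comm]
    rfl
  have h4 : q * -η ≤ q * E.stepError z a := by
    gcongr
    exact (abs_le.1 (he a)).1
  change _ ≤ Real.exp (q * logDist (E.pairStep a z)) * φ (E.Tt a z.1)
  rw [h3, ← mul_assoc, ← Real.exp_add, ← Real.exp_add, hstep]
  refine mul_le_mul_of_nonneg_right (Real.exp_le_exp.2 ?_) (hφ0 _)
  linarith

end Drift

/-! ### Correctors for the two-point motion -/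

/-- Functions which turn the logarithmic distance `s` of the two-point motion into an approximate
martingale `N = s + ψ`, its square into an approximate martingale `N ^ 2 + χ - n V`, and a
bounded function `w` whose growth in each step exceeds the distance, so that all the
errors, which are proportional to the distance, are absorbed by multiples of `w`. The estimates
hold at distances smaller than `R`; there one step changes `s` by at most `b`. -/
structure Corrector where
  /-- corrector of the logarithmic distance -/
  ψ : C(UnitAddCircle, ℝ)
  /-- corrector of the quadratic variation -/
  χ : C(UnitAddCircle, ℝ)
  /-- the bounded function which absorbs the errors -/
  w : UnitAddCircle × UnitAddCircle → ℝ
  /-- range of distances in which the estimates hold -/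
  R : ℝ
  /-- bound for the steps of the logarithmic distance -/
  b : ℝ
  /-- constant in the error estimates -/
  D : ℝ
  /-- bound for `w` -/
  M : ℝ
  R_pos : 0 < R
  R_le : R ≤ Real.exp (-1)
  b_nonneg : 0 ≤ b
  D_nonneg : 0 ≤ D
  M_nonneg : 0 ≤ M
  dist_pos : ∀ z, 0 < dist z.1 z.2 → dist z.1 z.2 < R → ∀ a,
    0 < dist (E.pairStep a z).1 (E.pairStep a z).2
  step_le : ∀ z, 0 < dist z.1 z.2 → dist z.1 z.2 < R → ∀ a,
    |logDist (E.pairStep a z) - logDist z| ≤ b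
  w_nonneg : ∀ z, 0 ≤ w z
  w_le : ∀ z, 0 < dist z.1 z.2 → dist z.1 z.2 < R → w z ≤ M
  integrable_w : ∀ z, 0 < dist z.1 z.2 → dist z.1 z.2 < R →
    Integrable (fun a => w (E.pairStep a z)) E.noise
  integrable_N : ∀ z, 0 < dist z.1 z.2 → dist z.1 z.2 < R →
    Integrable (fun a => logDist (E.pairStep a z) + ψ (E.pairStep a z).1) E.noise
  integrable_sq : ∀ z, 0 < dist z.1 z.2 → dist z.1 z.2 < R →
    Integrable (fun a => (logDist (E.pairStep a z) + ψ (E.pairStep a z).1) ^ 2) E.noise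
  drift_w : ∀ z, 0 < dist z.1 z.2 → dist z.1 z.2 < R →
    w z + dist z.1 z.2 ≤ ∫ a, w (E.pairStep a z) ∂E.noise
  drift_N : ∀ z, 0 < dist z.1 z.2 → dist z.1 z.2 < R →
    |(∫ a, (logDist (E.pairStep a z) + ψ (E.pairStep a z).1) ∂E.noise) - (logDist z + ψ z.1)| ≤
      D * dist z.1 z.2
  drift_sq : ∀ z, 0 < dist z.1 z.2 → dist z.1 z.2 < R →
    |(∫ a, (logDist (E.pairStep a z) + ψ (E.pairStep a z).1) ^ 2 ∂E.noise) +
        (∫ a, χ (E.pairStep a z).1 ∂E.noise) - ((logDist z + ψ z.1) ^ 2 + χ z.1 + E.V)| ≤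
      D * (1 + |logDist z + ψ z.1|) * dist z.1 z.2

theorem IsStationary.nonempty_corrector {E : RandomCircleMap} {μ : Measure UnitAddCircle}
    [IsProbabilityMeasure μ] (hμ : E.IsStationary μ) (hmin : E.Minorising)
    (hper : E.HasAttractingPeriodicOrbit) (hlyap : E.lyapunov μ = 0) : Nonempty E.Corrector := by
  obtain ⟨-, ψ, hψ, hVψ, hex⟩ := hμ.momentLyapunov_expansion hmin hlyap
  have hV : 0 < E.V := by
    rw [← hVψ]
    exact hμ.mean_incrementVar_pos hmin hper hψ
  obtain ⟨q, r, hq0, hq1, hr, φ, hφ0, hφ⟩ := hex hV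
  obtain ⟨χ, hχ⟩ := hμ.exists_poisson hmin (g := E.incrementVar ψ - E.V • 1) (by
    rw [map_sub, map_smul, mean_one, hVψ, smul_eq_mul, mul_one, sub_self])
  obtain ⟨R₁, C, hR₁, hC, hstep⟩ := E.exists_logDist_pairStep_bound
  have hR₂ : 0 < (r - 1) / (2 * (q * C * r + 1)) := by
    have : 0 < r - 1 := by linarith
    positivity
  obtain ⟨R, hRdef⟩ : ∃ R, R = min (min R₁ (Real.exp (-1))) ((r - 1) / (2 * (q * C * r + 1))) :=
    ⟨_, rfl⟩
  have hR : 0 < R := by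
    rw [hRdef]
    exact lt_min (lt_min hR₁ (Real.exp_pos _)) hR₂
  have hRR₁ : R ≤ R₁ := hRdef ▸ (min_le_left _ _).trans (min_le_left _ _)
  have hRe : R ≤ Real.exp (-1) := hRdef ▸ (min_le_left _ _).trans (min_le_right _ _)
  have hRR₂ : R ≤ (r - 1) / (2 * (q * C * r + 1)) := hRdef ▸ min_le_right _ _
  have hR1 : R < 1 := hRe.trans_lt (Real.exp_lt_one_iff.2 (by norm_num))
  have hφn : ∀ x, 0 ≤ φ x := fun x => by linarith [hφ0 x]
  have hr1 : 0 < r - 1 := by linarith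
  have herr : ∀ z : UnitAddCircle × UnitAddCircle, 0 < dist z.1 z.2 → dist z.1 z.2 < R → ∀ a,
      |E.stepError z a| ≤ C * dist z.1 z.2 := fun z h1 h2 a => (hstep z h1 (h2.trans_le hRR₁) a).2
  have hdist : ∀ z : UnitAddCircle × UnitAddCircle, 0 < dist z.1 z.2 →
      Real.exp (logDist z) = dist z.1 z.2 := fun z h => Real.exp_log h
  refine ⟨{
    ψ := ψ
    χ := χ
    w := fun z => 4 / (r - 1) * (Real.exp (q * logDist z) * φ z.1)
    R := R
    b := ‖E.logDT‖ + C
    D := (2 + (2 * (‖E.logDT‖ + 2 * ‖ψ‖) + C)) * C + C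
    M := 4 / (r - 1) * ‖φ‖
    R_pos := hR
    R_le := hRe
    b_nonneg := by positivity
    D_nonneg := by positivity
    M_nonneg := by positivity
    dist_pos := fun z h1 h2 a => (hstep z h1 (h2.trans_le hRR₁) a).1
    step_le := fun z h1 h2 a => ?_
    w_nonneg := fun z => mul_nonneg (by positivity) (mul_nonneg (Real.exp_pos _).le (hφn _))
    w_le := fun z h1 h2 => ?_
    integrable_w := fun z h1 h2 => (drift_dist_rpow hq0 hφn hφ (herr z h1 h2)).1.const_mul _
    integrable_N := fun z h1 h2 => (drift_corrected_logDist hψ (herr z h1 h2)).1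
    integrable_sq := fun z h1 h2 => (drift_corrected_logDist hψ (herr z h1 h2)).2.1
    drift_w := fun z h1 h2 => ?_
    drift_N := fun z h1 h2 => ?_
    drift_sq := fun z h1 h2 => ?_ }⟩
  · have h3 := abs_le.1 (herr z h1 h2 a)
    have h4 := abs_le.1 (E.logDT.norm_coe_le_norm (z.1 + (a : UnitAddCircle)))
    have h5 : C * dist z.1 z.2 ≤ C * 1 := by
      gcongr
      linarith
    rw [stepError] at h3
    rw [abs_le]
    constructor <;> linarith [h3.1, h3.2, h4.1, h4.2]
  · have h3 : logDist z ≤ 0 := Real.log_nonpos h1.le (by linarith)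
    have h4 : Real.exp (q * logDist z) ≤ 1 :=
      Real.exp_le_one_iff.2 (mul_nonpos_of_nonneg_of_nonpos hq0.le h3)
    have h5 : φ z.1 ≤ ‖φ‖ := (le_abs_self _).trans (φ.norm_coe_le_norm _)
    have h6 : Real.exp (q * logDist z) * φ z.1 ≤ 1 * ‖φ‖ := by
      gcongr
      exact hφn _
    rw [one_mul] at h6
    gcongr
  · have h3 := (drift_dist_rpow hq0 hφn hφ (herr z h1 h2)).2
    have h4 : logDist z ≤ 0 := Real.log_nonpos h1.le (by linarith)
    have h5 : dist z.1 z.2 ≤ Real.exp (q * logDist z) := by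
      rw [← hdist z h1]
      exact Real.exp_le_exp.2 (by nlinarith)
    -- the choice of `R` keeps the growth factor above `(1 + r) / 2`
    have h6 : (1 + r) / 2 ≤ Real.exp (-(q * (C * dist z.1 z.2))) * r := by
      have h7 : 1 - q * (C * dist z.1 z.2) ≤ Real.exp (-(q * (C * dist z.1 z.2))) := by
        linarith [Real.add_one_le_exp (-(q * (C * dist z.1 z.2)))]
      have h8 : q * C * r * dist z.1 z.2 ≤ q * C * r * ((r - 1) / (2 * (q * C * r + 1))) := by
        have : 0 ≤ q * C * r := by positivity
        gcongr
        linarith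
      have h9 : q * C * r * ((r - 1) / (2 * (q * C * r + 1))) ≤ (r - 1) / 2 := by
        have h10 : 0 ≤ q * C * r := by positivity
        rw [mul_div_assoc', div_le_div_iff₀ (by positivity) (by positivity)]
        nlinarith
      nlinarith
    rw [integral_const_mul]
    have hW : 1 / 2 * dist z.1 z.2 ≤ Real.exp (q * logDist z) * φ z.1 := by
      rw [mul_comm]
      gcongr
      exact hφ0 _
    have h11 : (1 + r) / 2 * (Real.exp (q * logDist z) * φ z.1) ≤
        ∫ a, Real.exp (q * logDist (E.pairStep a z)) * φ (E.pairStep a z).1 ∂E.noise := by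
      refine le_trans ?_ h3
      rw [← mul_assoc (Real.exp (-(q * (C * dist z.1 z.2))))]
      gcongr
      exact mul_nonneg (Real.exp_pos _).le (hφn _)
    generalize Real.exp (q * logDist z) * φ z.1 = W at *
    have h12 : 4 / (r - 1) * ((1 + r) / 2 * W) = 4 / (r - 1) * W + 2 * W := by
      field_simp
      ring
    have h13 : 4 / (r - 1) * ((1 + r) / 2 * W) ≤ 4 / (r - 1) *
        ∫ a, Real.exp (q * logDist (E.pairStep a z)) * φ (E.pairStep a z).1 ∂E.noise := by
      gcongr
    linarith
  · refine (drift_corrected_logDist hψ (herr z h1 h2)).2.2.1.trans ?_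
    gcongr
    have : 0 ≤ (2 + (2 * (‖E.logDT‖ + 2 * ‖ψ‖) + C)) * C := by positivity
    linarith
  · have h3 := (drift_corrected_logDist hψ (herr z h1 h2)).2.2.2
    have h4 : ∫ a, χ (E.pairStep a z).1 ∂E.noise = χ z.1 - (E.incrementVar ψ z.1 - E.V) := by
      have h5 := congrArg (fun f : C(UnitAddCircle, ℝ) => f z.1) hχ
      simp only [ContinuousMap.sub_apply, ContinuousMap.smul_apply, ContinuousMap.one_apply,
        smul_eq_mul, mul_one, transfer_zero_apply] at h5
      change ∫ a, χ (E.Tt a z.1) ∂E.noise = _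
      linarith
    rw [h4]
    have h6 : ∀ I : ℝ, I + (χ z.1 - (E.incrementVar ψ z.1 - E.V)) -
        ((logDist z + ψ z.1) ^ 2 + χ z.1 + E.V) = I - (logDist z + ψ z.1) ^ 2 -
          E.incrementVar ψ z.1 := fun I => by ring
    rw [h6]
    refine h3.trans ?_
    rw [← mul_assoc]
    have h7 : C * dist z.1 z.2 ≤ C := by
      have : C * dist z.1 z.2 ≤ C * 1 := by
        gcongr
        linarith
      linarith
    have h8 : 0 ≤ |logDist z + ψ z.1| := abs_nonneg _
    have h9 : 0 ≤ ‖E.logDT‖ + 2 * ‖ψ‖ := by positivity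
    refine mul_le_mul_of_nonneg_right ?_ h1.le
    generalize |logDist z + ψ z.1| = n at *
    generalize ‖E.logDT‖ + 2 * ‖ψ‖ = B at *
    have h10 : (2 * n + 2 * B + C * dist z.1 z.2) * C ≤ (2 * n + 2 * B + C) * C := by gcongr
    nlinarith [mul_nonneg h8 hC, mul_nonneg h9 hC, mul_nonneg (mul_nonneg h9 hC) h8,
      mul_nonneg (mul_nonneg hC hC) h8]

/-! ### Estimates for the exit of the two-point distance from an interval -/

theorem integral_affine {f g h k : ℝ → ℝ} (hf : Integrable f E.noise) (hg : Integrable g E.noise)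
    (hh : Integrable h E.noise) (hk : Integrable k E.noise) (c₀ c₁ c₂ c₃ c₄ : ℝ) :
    Integrable (fun a => c₀ + (c₁ * f a + (c₂ * g a + (c₃ * h a + c₄ * k a)))) E.noise ∧
    ∫ a, (c₀ + (c₁ * f a + (c₂ * g a + (c₃ * h a + c₄ * k a)))) ∂E.noise =
      c₀ + (c₁ * (∫ a, f a ∂E.noise) + (c₂ * (∫ a, g a ∂E.noise) +
        (c₃ * (∫ a, h a ∂E.noise) + c₄ * ∫ a, k a ∂E.noise))) := by
  have i3 : Integrable (fun a => c₃ * h a + c₄ * k a) E.noise :=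
    (hh.const_mul c₃).add (hk.const_mul c₄)
  have i2 : Integrable (fun a => c₂ * g a + (c₃ * h a + c₄ * k a)) E.noise :=
    (hg.const_mul c₂).add i3
  have i1 : Integrable (fun a => c₁ * f a + (c₂ * g a + (c₃ * h a + c₄ * k a))) E.noise :=
    (hf.const_mul c₁).add i2
  refine ⟨(integrable_const _).add i1, ?_⟩
  rw [integral_add (integrable_const _) i1, integral_add (hf.const_mul _) i2,
    integral_add (hg.const_mul _) i3, integral_add (hh.const_mul _) (hk.const_mul _),
    integral_const_mul, integral_const_mul, integral_const_mul, integral_const_mul]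
  simp

/-- Pairs of points with distance in `[ε, δ]`. -/
def band (ε δ : ℝ) : Set (UnitAddCircle × UnitAddCircle) :=
  {z | ε ≤ dist z.1 z.2 ∧ dist z.1 z.2 ≤ δ}

theorem measurableSet_band (ε δ : ℝ) : MeasurableSet (band ε δ) :=
  (measurableSet_le measurable_const continuous_dist.measurable).inter
    (measurableSet_le continuous_dist.measurable measurable_const)

namespace Corrector

variable {E} (K : E.Corrector)

/-- The corrected logarithmic distance. -/
def N (z : UnitAddCircle × UnitAddCircle) : ℝ := logDist z + K.ψ z.1

/-- Linear combinations of the correctors: the drift functions are all of this form. -/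
def comb (c₀ c₁ c₂ c₃ c₄ : ℝ) (z : UnitAddCircle × UnitAddCircle) : ℝ :=
  c₀ + (c₁ * K.N z + (c₂ * K.N z ^ 2 + (c₃ * K.χ z.1 + c₄ * K.w z)))

/-- Pairs of points whose distance lies in `[ε, δ]` up to one step of the motion. -/
def reach (ε δ : ℝ) : Set (UnitAddCircle × UnitAddCircle) :=
  {z | 0 < dist z.1 z.2 ∧ Real.log ε - K.b ≤ logDist z ∧ logDist z ≤ Real.log δ + K.b}

variable {K} {ε δ : ℝ}

theorem log_mem_of_mem_band (hε : 0 < ε) {z : UnitAddCircle × UnitAddCircle} (hz : z ∈ band ε δ) :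
    0 < dist z.1 z.2 ∧ Real.log ε ≤ logDist z ∧ logDist z ≤ Real.log δ :=
  have h := hε.trans_le hz.1
  ⟨h, Real.log_le_log hε hz.1, Real.log_le_log h hz.2⟩

theorem dist_lt_of_mem_band (hδR : δ < Real.exp (-K.b) * K.R)
    {z : UnitAddCircle × UnitAddCircle} (hz : z ∈ band ε δ) : dist z.1 z.2 < K.R := by
  have h1 : Real.exp (-K.b) ≤ 1 := Real.exp_le_one_iff.2 (by linarith [K.b_nonneg])
  have h2 : Real.exp (-K.b) * K.R ≤ 1 * K.R := by
    gcongr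
    exact K.R_pos.le
  linarith [hz.2]

theorem mem_reach_of_mem_band (hε : 0 < ε) {z : UnitAddCircle × UnitAddCircle}
    (hz : z ∈ band ε δ) : z ∈ K.reach ε δ := by
  obtain ⟨h1, h2, h3⟩ := log_mem_of_mem_band hε hz
  exact ⟨h1, by linarith [K.b_nonneg], by linarith [K.b_nonneg]⟩

theorem step_mem_reach (hε : 0 < ε) (hδR : δ < Real.exp (-K.b) * K.R)
    {z : UnitAddCircle × UnitAddCircle} (hz : z ∈ band ε δ) (a : ℝ) :
    E.pairStep a z ∈ K.reach ε δ := by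
  obtain ⟨h1, h2, h3⟩ := log_mem_of_mem_band hε hz
  have h4 := dist_lt_of_mem_band hδR hz
  have h5 := abs_le.1 (K.step_le z h1 h4 a)
  exact ⟨K.dist_pos z h1 h4 a, by linarith [h5.1], by linarith [h5.2]⟩

theorem dist_lt_of_mem_reach (hδ : 0 < δ) (hδR : δ < Real.exp (-K.b) * K.R)
    {z : UnitAddCircle × UnitAddCircle} (hz : z ∈ K.reach ε δ) : dist z.1 z.2 < K.R := by
  have h1 : Real.log δ < -K.b + Real.log K.R := by
    have := Real.log_lt_log hδ hδR
    rwa [Real.log_mul (Real.exp_pos _).ne' K.R_pos.ne', Real.log_exp] at this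
  exact (Real.log_lt_log_iff hz.1 K.R_pos).1 (show logDist z < _ by linarith [hz.2.2])

theorem w_mem_of_mem_reach (hδ : 0 < δ) (hδR : δ < Real.exp (-K.b) * K.R)
    {z : UnitAddCircle × UnitAddCircle} (hz : z ∈ K.reach ε δ) : 0 ≤ K.w z ∧ K.w z ≤ K.M :=
  ⟨K.w_nonneg z, K.w_le z hz.1 (dist_lt_of_mem_reach hδ hδR hz)⟩

theorem abs_N_sub_le (z : UnitAddCircle × UnitAddCircle) : |K.N z - logDist z| ≤ ‖K.ψ‖ := by
  rw [N, add_sub_cancel_left]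
  exact K.ψ.norm_coe_le_norm _

theorem log_lt_neg_one (hδ : 0 < δ) (hδR : δ < Real.exp (-K.b) * K.R) : Real.log δ < -1 := by
  have h1 : Real.log δ < -K.b + Real.log K.R := by
    have := Real.log_lt_log hδ hδR
    rwa [Real.log_mul (Real.exp_pos _).ne' K.R_pos.ne', Real.log_exp] at this
  have h2 : Real.log K.R ≤ -1 := by
    have := Real.log_le_log K.R_pos K.R_le
    rwa [Real.log_exp] at this
  linarith [K.b_nonneg]

theorem comb_step {z : UnitAddCircle × UnitAddCircle} (h1 : 0 < dist z.1 z.2)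
    (h2 : dist z.1 z.2 < K.R) (c₀ c₁ c₂ c₃ c₄ : ℝ) :
    Integrable (fun a => K.comb c₀ c₁ c₂ c₃ c₄ (E.pairStep a z)) E.noise ∧
    ∫ a, K.comb c₀ c₁ c₂ c₃ c₄ (E.pairStep a z) ∂E.noise =
      c₀ + (c₁ * (∫ a, K.N (E.pairStep a z) ∂E.noise) +
        (c₂ * (∫ a, K.N (E.pairStep a z) ^ 2 ∂E.noise) +
        (c₃ * (∫ a, K.χ (E.pairStep a z).1 ∂E.noise) +
          c₄ * ∫ a, K.w (E.pairStep a z) ∂E.noise))) := by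
  have hχ : Integrable (fun a => K.χ (E.pairStep a z).1) E.noise :=
    E.integrable_noise (C := ‖K.χ‖) (K.χ.continuous.measurable.comp
      (measurable_fst.comp (E.measurable_pairStep_left z))) fun a => K.χ.norm_coe_le_norm _
  exact E.integral_affine (K.integrable_N z h1 h2) (K.integrable_sq z h1 h2) hχ
    (K.integrable_w z h1 h2) c₀ c₁ c₂ c₃ c₄

theorem measurable_pairStep : Measurable fun p : ℝ × (UnitAddCircle × UnitAddCircle) =>
    E.pairStep p.1 p.2 := E.continuous_pairStep.measurable

variable (K) in
/-- Constant in the estimates of the exit probabilities. -/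
def hitConst : ℝ := K.b + ‖K.ψ‖ + K.D * K.M

theorem hitConst_nonneg : 0 ≤ K.hitConst := by
  have := K.b_nonneg
  have := K.D_nonneg
  have := K.M_nonneg
  unfold hitConst
  positivity

/-- Drift comparison for the exit through the lower end of the band. -/
theorem measureReal_hit_below_le (hε : 0 < ε) (hεδ : ε < δ) (hδR : δ < Real.exp (-K.b) * K.R)
    {z : UnitAddCircle × UnitAddCircle} (hz : z ∈ band ε δ) (n : ℕ) :
    E.ℙ.real (hitEvent E.pairStep (band ε δ) {z | dist z.1 z.2 < ε} n z) ≤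
      (Real.log δ - logDist z + (‖K.ψ‖ + K.hitConst)) / (Real.log δ - Real.log ε) := by
  have hδ := hε.trans hεδ
  have hL : 0 < Real.log δ - Real.log ε := sub_pos.2 (Real.log_lt_log hε hεδ)
  set L := Real.log δ - Real.log ε with hLdef
  have hDM : 0 ≤ K.D * K.M := mul_nonneg K.D_nonneg K.M_nonneg
  have hform : ∀ z, K.comb ((Real.log δ + K.hitConst) / L) (-(1 / L)) 0 0 (-(K.D / L)) z =
      (Real.log δ + K.hitConst - K.N z - K.D * K.w z) / L := fun z => by
    rw [comb]
    field_simp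
    ring
  have hDw : ∀ z ∈ K.reach ε δ, 0 ≤ K.D * K.w z ∧ K.D * K.w z ≤ K.D * K.M := fun z hz =>
    have h := w_mem_of_mem_reach hδ hδR hz
    ⟨mul_nonneg K.D_nonneg h.1, mul_le_mul_of_nonneg_left h.2 K.D_nonneg⟩
  have hzr := mem_reach_of_mem_band (K := K) hε hz
  refine (measureReal_hitEvent_le (G := K.reach ε δ)
    (U := K.comb ((Real.log δ + K.hitConst) / L) (-(1 / L)) 0 0 (-(K.D / L)))
    measurable_pairStep (measurableSet_band ε δ)
    (measurableSet_lt continuous_dist.measurable measurable_const)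
    (fun z hz a => step_mem_reach hε hδR hz a)
    (fun z hz => (comb_step (log_mem_of_mem_band hε hz).1 (dist_lt_of_mem_band hδR hz) _ _ _ _ _).1)
    (fun z hz => ?_) (fun z hz hzB => ?_) (fun z hz => ?_) n hzr).trans ?_
  · rw [hform]
    refine div_nonneg ?_ hL.le
    have h1 := abs_le.1 (abs_N_sub_le (K := K) z)
    rw [hitConst]
    linarith [hz.2.2, h1.2, (hDw z hz).2]
  · rw [hform, le_div_iff₀ hL]
    have h1 := abs_le.1 (abs_N_sub_le (K := K) z)
    have h2 : logDist z ≤ Real.log ε := Real.log_le_log hz.1 (le_of_lt hzB)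
    rw [hitConst]
    linarith [h1.2, (hDw z hz).2, K.b_nonneg]
  · have h1 := (log_mem_of_mem_band hε hz).1
    have h2 := dist_lt_of_mem_band (K := K) hδR hz
    rw [(comb_step h1 h2 _ _ _ _ _).2, hform, le_div_iff₀ hL]
    have h3 := (abs_le.1 (K.drift_N z h1 h2)).1
    have h4 := mul_le_mul_of_nonneg_left (K.drift_w z h1 h2) K.D_nonneg
    change -(K.D * dist z.1 z.2) ≤ (∫ a, K.N (E.pairStep a z) ∂E.noise) - K.N z at h3
    generalize ∫ a, K.N (E.pairStep a z) ∂E.noise = I at *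
    generalize ∫ a, K.w (E.pairStep a z) ∂E.noise = J at *
    have h5 : ((Real.log δ + K.hitConst) / L + (-(1 / L) * I + (0 * (∫ a, K.N (E.pairStep a z) ^ 2
        ∂E.noise) + (0 * (∫ a, K.χ (E.pairStep a z).1 ∂E.noise) + -(K.D / L) * J)))) * L =
        Real.log δ + K.hitConst - I - K.D * J := by
      field_simp
      ring
    rw [h5]
    linarith
  · rw [hform]
    gcongr
    have h1 := abs_le.1 (abs_N_sub_le (K := K) z)
    linarith [h1.1, (hDw z hzr).1]

/-- Drift comparison for the exit through the upper end of the band. -/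
theorem measureReal_hit_above_le (hε : 0 < ε) (hεδ : ε < δ) (hδR : δ < Real.exp (-K.b) * K.R)
    {z : UnitAddCircle × UnitAddCircle} (hz : z ∈ band ε δ) (n : ℕ) :
    E.ℙ.real (hitEvent E.pairStep (band ε δ) {z | δ < dist z.1 z.2} n z) ≤
      (logDist z - Real.log ε + (‖K.ψ‖ + K.hitConst)) / (Real.log δ - Real.log ε) := by
  have hδ := hε.trans hεδ
  have hL : 0 < Real.log δ - Real.log ε := sub_pos.2 (Real.log_lt_log hε hεδ)
  set L := Real.log δ - Real.log ε with hLdef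
  have hDM : 0 ≤ K.D * K.M := mul_nonneg K.D_nonneg K.M_nonneg
  have hform : ∀ z, K.comb ((K.hitConst - Real.log ε) / L) (1 / L) 0 0 (-(K.D / L)) z =
      (K.hitConst - Real.log ε + K.N z - K.D * K.w z) / L := fun z => by
    rw [comb]
    field_simp
    ring
  have hDw : ∀ z ∈ K.reach ε δ, 0 ≤ K.D * K.w z ∧ K.D * K.w z ≤ K.D * K.M := fun z hz =>
    have h := w_mem_of_mem_reach hδ hδR hz
    ⟨mul_nonneg K.D_nonneg h.1, mul_le_mul_of_nonneg_left h.2 K.D_nonneg⟩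
  have hzr := mem_reach_of_mem_band (K := K) hε hz
  refine (measureReal_hitEvent_le (G := K.reach ε δ)
    (U := K.comb ((K.hitConst - Real.log ε) / L) (1 / L) 0 0 (-(K.D / L)))
    measurable_pairStep (measurableSet_band ε δ)
    (measurableSet_lt measurable_const continuous_dist.measurable)
    (fun z hz a => step_mem_reach hε hδR hz a)
    (fun z hz => (comb_step (log_mem_of_mem_band hε hz).1 (dist_lt_of_mem_band hδR hz) _ _ _ _ _).1)
    (fun z hz => ?_) (fun z hz hzB => ?_) (fun z hz => ?_) n hzr).trans ?_
  · rw [hform]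
    refine div_nonneg ?_ hL.le
    have h1 := abs_le.1 (abs_N_sub_le (K := K) z)
    rw [hitConst]
    linarith [hz.2.1, h1.1, (hDw z hz).2]
  · rw [hform, le_div_iff₀ hL]
    have h1 := abs_le.1 (abs_N_sub_le (K := K) z)
    have h2 : Real.log δ ≤ logDist z := Real.log_le_log hδ (le_of_lt hzB)
    rw [hitConst]
    linarith [h1.1, (hDw z hz).2, K.b_nonneg]
  · have h1 := (log_mem_of_mem_band hε hz).1
    have h2 := dist_lt_of_mem_band (K := K) hδR hz
    rw [(comb_step h1 h2 _ _ _ _ _).2, hform, le_div_iff₀ hL]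
    have h3 := (abs_le.1 (K.drift_N z h1 h2)).2
    have h4 := mul_le_mul_of_nonneg_left (K.drift_w z h1 h2) K.D_nonneg
    change (∫ a, K.N (E.pairStep a z) ∂E.noise) - K.N z ≤ K.D * dist z.1 z.2 at h3
    generalize ∫ a, K.N (E.pairStep a z) ∂E.noise = I at *
    generalize ∫ a, K.w (E.pairStep a z) ∂E.noise = J at *
    have h5 : ((K.hitConst - Real.log ε) / L + (1 / L * I + (0 * (∫ a, K.N (E.pairStep a z) ^ 2
        ∂E.noise) + (0 * (∫ a, K.χ (E.pairStep a z).1 ∂E.noise) + -(K.D / L) * J)))) * L =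
        K.hitConst - Real.log ε + I - K.D * J := by
      field_simp
      ring
    rw [h5]
    linarith
  · rw [hform]
    gcongr
    have h1 := abs_le.1 (abs_N_sub_le (K := K) z)
    linarith [h1.2, (hDw z hzr).1]

end Corrector

namespace Corrector

variable {E} {K : E.Corrector} {ε δ : ℝ}

variable (K) in
/-- Constant in the drift estimate of the quadratic functional. -/
def quadConst : ℝ := K.D * (4 + ‖K.ψ‖)

theorem quadConst_nonneg : 0 ≤ K.quadConst :=
  mul_nonneg K.D_nonneg (by positivity)

/-- The functional `(ln δ - N) (N - ln ε) - χ` decreases on average by `V` in each step, up to an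
error which is proportional to `|ln ε|` and to the distance. -/
theorem abs_quad_drift_le (hε : 0 < ε) (hεδ : ε < δ) (hδR : δ < Real.exp (-K.b) * K.R)
    {z : UnitAddCircle × UnitAddCircle} (hz : z ∈ band ε δ) :
    |(Real.log δ + Real.log ε) * ((∫ a, K.N (E.pairStep a z) ∂E.noise) - K.N z) -
      ((∫ a, K.N (E.pairStep a z) ^ 2 ∂E.noise) + (∫ a, K.χ (E.pairStep a z).1 ∂E.noise) -
        (K.N z ^ 2 + K.χ z.1 + E.V))| ≤ K.quadConst * -Real.log ε * dist z.1 z.2 := by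
  have hδ := hε.trans hεδ
  obtain ⟨h1, hs1, hs2⟩ := log_mem_of_mem_band hε hz
  have h2 := dist_lt_of_mem_band (K := K) hδR hz
  have hδ1 := log_lt_neg_one hδ hδR
  have hεδ' := Real.log_lt_log hε hεδ
  have hN := K.drift_N z h1 h2
  have hsq := K.drift_sq z h1 h2
  change |(∫ a, K.N (E.pairStep a z) ∂E.noise) - K.N z| ≤ _ at hN
  change |(∫ a, K.N (E.pairStep a z) ^ 2 ∂E.noise) + (∫ a, K.χ (E.pairStep a z).1 ∂E.noise) -
        (K.N z ^ 2 + K.χ z.1 + E.V)| ≤ K.D * (1 + |K.N z|) * dist z.1 z.2 at hsq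
  have hD := K.D_nonneg
  have hNz : |K.N z| ≤ -Real.log ε + ‖K.ψ‖ := by
    have h3 := abs_le.1 (abs_N_sub_le (K := K) z)
    rw [abs_le]
    constructor <;> linarith [h3.1, h3.2]
  refine (abs_sub _ _).trans ?_
  rw [abs_mul]
  have h4 : |Real.log δ + Real.log ε| ≤ 2 * -Real.log ε := by
    rw [abs_le]
    constructor <;> linarith
  have h5 : |Real.log δ + Real.log ε| * |(∫ a, K.N (E.pairStep a z) ∂E.noise) - K.N z| ≤
      2 * -Real.log ε * (K.D * dist z.1 z.2) := by
    gcongr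
    linarith
  have h6 : K.D * (1 + |K.N z|) * dist z.1 z.2 ≤
      K.D * (-Real.log ε + (-Real.log ε + ‖K.ψ‖ * -Real.log ε)) * dist z.1 z.2 := by
    gcongr
    · linarith
    · nlinarith [norm_nonneg K.ψ]
  have h7 : K.quadConst * -Real.log ε * dist z.1 z.2 = 2 * -Real.log ε * (K.D * dist z.1 z.2) +
      K.D * (-Real.log ε + (-Real.log ε + ‖K.ψ‖ * -Real.log ε)) * dist z.1 z.2 := by
    rw [quadConst]
    ring
  linarith

variable (K) in
/-- Constant in the estimates of the mean exit time. -/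
def meanConst : ℝ :=
  ‖K.ψ‖ + ‖K.ψ‖ ^ 2 + 2 * ‖K.χ‖ + (K.b + ‖K.ψ‖) + (K.b + ‖K.ψ‖) ^ 2 + K.quadConst * K.M

theorem meanConst_nonneg : 0 ≤ K.meanConst := by
  have := K.b_nonneg
  have := quadConst_nonneg (K := K)
  have := K.M_nonneg
  unfold meanConst
  positivity

variable (K) in
/-- The functional `(ln δ - N) (N - ln ε) - χ + c₀ |ln ε| + c₄ |ln ε| w`. -/
def quadFun (ε δ c₀ c₄ : ℝ) : UnitAddCircle × UnitAddCircle → ℝ :=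
  K.comb (-(Real.log δ * Real.log ε) + c₀ * -Real.log ε) (Real.log δ + Real.log ε) (-1) (-1)
    (c₄ * -Real.log ε)

theorem quadFun_eq (ε δ c₀ c₄ : ℝ) (z : UnitAddCircle × UnitAddCircle) :
    K.quadFun ε δ c₀ c₄ z = (Real.log δ - K.N z) * (K.N z - Real.log ε) - K.χ z.1 +
      c₀ * -Real.log ε + c₄ * -Real.log ε * K.w z := by
  rw [quadFun, comb]
  ring

theorem quad_N_bounds (hε : 0 < ε) (hεδ : ε < δ) (hδR : δ < Real.exp (-K.b) * K.R)
    {z : UnitAddCircle × UnitAddCircle} (hz : z ∈ band ε δ) :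
    |(Real.log δ - K.N z) * (K.N z - Real.log ε) -
      (Real.log δ - logDist z) * (logDist z - Real.log ε)| ≤
        (‖K.ψ‖ + ‖K.ψ‖ ^ 2) * -Real.log ε := by
  obtain ⟨h1, hs1, hs2⟩ := log_mem_of_mem_band hε hz
  have hδ1 := log_lt_neg_one (hε.trans hεδ) hδR
  have hεδ' := Real.log_lt_log hε hεδ
  have hψ := abs_N_sub_le (K := K) z
  obtain ⟨p, hp⟩ : ∃ p, p = K.N z - logDist z := ⟨_, rfl⟩
  have hN : K.N z = logDist z + p := by rw [hp]; ring
  rw [← hp] at hψ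
  rw [hN]
  have h2 : (Real.log δ - (logDist z + p)) * (logDist z + p - Real.log ε) -
      (Real.log δ - logDist z) * (logDist z - Real.log ε) =
      p * (Real.log δ + Real.log ε - 2 * logDist z) - p ^ 2 := by ring
  rw [h2]
  refine (abs_sub _ _).trans ?_
  rw [abs_mul, abs_pow]
  have h3 : |Real.log δ + Real.log ε - 2 * logDist z| ≤ -Real.log ε := by
    rw [abs_le]
    constructor <;> linarith
  have h4 : |p| * |Real.log δ + Real.log ε - 2 * logDist z| ≤ ‖K.ψ‖ * -Real.log ε := by gcongr
  have h5 : |p| ^ 2 ≤ ‖K.ψ‖ ^ 2 := pow_le_pow_left₀ (abs_nonneg _) hψ 2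
  nlinarith [sq_nonneg ‖K.ψ‖]

theorem sum_stay_le (hε : 0 < ε) (hεδ : ε < δ) (hδR : δ < Real.exp (-K.b) * K.R)
    {z : UnitAddCircle × UnitAddCircle} (hz : z ∈ band ε δ) (n : ℕ) :
    E.V * ∑ j ∈ Finset.range n, E.ℙ.real (stayEvent E.pairStep (band ε δ) (j + 1) z) ≤
      (Real.log δ - logDist z) * (logDist z - Real.log ε) + K.meanConst * -Real.log ε := by
  have hδ := hε.trans hεδ
  have hδ1 := log_lt_neg_one hδ hδR
  have hεδ' := Real.log_lt_log hε hεδ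
  have hb := K.b_nonneg
  have hQ := quadConst_nonneg (K := K)
  have hM := K.M_nonneg
  have hzr := mem_reach_of_mem_band (K := K) hε hz
  set c₀ := (K.b + ‖K.ψ‖) + (K.b + ‖K.ψ‖) ^ 2 + ‖K.χ‖ + K.quadConst * K.M with hc₀
  have hQw : ∀ z ∈ K.reach ε δ, 0 ≤ K.quadConst * -Real.log ε * K.w z ∧
      K.quadConst * -Real.log ε * K.w z ≤ K.quadConst * K.M * -Real.log ε := fun z hz => by
    have h := w_mem_of_mem_reach hδ hδR hz
    have h1 : 0 ≤ K.quadConst * -Real.log ε := mul_nonneg hQ (by linarith)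
    exact ⟨mul_nonneg h1 h.1, by nlinarith [mul_le_mul_of_nonneg_left h.2 h1]⟩
  have hχ : ∀ z : UnitAddCircle × UnitAddCircle, |K.χ z.1| ≤ ‖K.χ‖ * -Real.log ε := fun z => by
    have h := K.χ.norm_coe_le_norm z.1
    rw [Real.norm_eq_abs] at h
    nlinarith [norm_nonneg K.χ]
  refine (sum_stayEvent_le (G := K.reach ε δ) (U := K.quadFun ε δ c₀ (-K.quadConst))
    measurable_pairStep (measurableSet_band ε δ) (fun z hz a => step_mem_reach hε hδR hz a)
    (fun z hz => (comb_step (log_mem_of_mem_band hε hz).1 (dist_lt_of_mem_band hδR hz) _ _ _ _ _).1)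
    (fun z hz => ?_) (fun z hz => ?_) n hzr).trans ?_
  · rw [quadFun_eq]
    have h1 := abs_le.1 (abs_N_sub_le (K := K) z)
    have h2 : 0 ≤ Real.log δ + (K.b + ‖K.ψ‖) - K.N z := by linarith [hz.2.2, h1.2]
    have h3 : 0 ≤ K.N z - Real.log ε + (K.b + ‖K.ψ‖) := by linarith [hz.2.1, h1.1]
    have h4 := mul_nonneg h2 h3
    have h5 := (hQw z hz).2
    have h6 := (abs_le.1 (hχ z)).2
    have h7 : (K.b + ‖K.ψ‖) * (Real.log δ - Real.log ε) ≤ (K.b + ‖K.ψ‖) * -Real.log ε := by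
      gcongr
      linarith
    have h8 : (K.b + ‖K.ψ‖) ^ 2 ≤ (K.b + ‖K.ψ‖) ^ 2 * -Real.log ε := by
      nlinarith [sq_nonneg (K.b + ‖K.ψ‖)]
    rw [hc₀]
    nlinarith
  · have h1 := (log_mem_of_mem_band hε hz).1
    have h2 := dist_lt_of_mem_band (K := K) hδR hz
    rw [quadFun, (comb_step h1 h2 _ _ _ _ _).2, comb]
    have h3 := (abs_le.1 (abs_quad_drift_le hε hεδ hδR hz)).2
    have h4 := mul_le_mul_of_nonneg_left (K.drift_w z h1 h2)
      (show 0 ≤ K.quadConst * -Real.log ε from mul_nonneg hQ (by linarith))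
    linarith
  · rw [quadFun_eq]
    have h1 := (abs_le.1 (quad_N_bounds (K := K) hε hεδ hδR hz)).2
    have h2 := (hQw z hzr).1
    have h3 := (abs_le.1 (hχ z)).1
    rw [meanConst, hc₀]
    linarith

theorem exists_le_sum_stay (hε : 0 < ε) (hεδ : ε < δ) (hδR : δ < Real.exp (-K.b) * K.R)
    {z : UnitAddCircle × UnitAddCircle} (hz : z ∈ band ε δ) : ∃ C : ℝ, ∀ n : ℕ,
      (Real.log δ - logDist z) * (logDist z - Real.log ε) - K.meanConst * -Real.log ε ≤
      E.V * ∑ j ∈ Finset.range n, E.ℙ.real (stayEvent E.pairStep (band ε δ) (j + 1) z) +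
        C * E.ℙ.real (stayEvent E.pairStep (band ε δ) n z) := by
  have hδ := hε.trans hεδ
  have hδ1 := log_lt_neg_one hδ hδR
  have hεδ' := Real.log_lt_log hε hεδ
  have hb := K.b_nonneg
  have hQ := quadConst_nonneg (K := K)
  have hM := K.M_nonneg
  have hzr := mem_reach_of_mem_band (K := K) hε hz
  set c₀ := (K.b + ‖K.ψ‖) + ‖K.χ‖ + K.quadConst * K.M with hc₀
  have hc₀0 : 0 ≤ c₀ := by positivity
  have hl : 0 ≤ -Real.log ε := by linarith
  have hQw : ∀ z ∈ K.reach ε δ, 0 ≤ K.quadConst * -Real.log ε * K.w z ∧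
      K.quadConst * -Real.log ε * K.w z ≤ K.quadConst * K.M * -Real.log ε := fun z hz => by
    have h := w_mem_of_mem_reach hδ hδR hz
    have h1 : 0 ≤ K.quadConst * -Real.log ε := mul_nonneg hQ hl
    exact ⟨mul_nonneg h1 h.1, by nlinarith [mul_le_mul_of_nonneg_left h.2 h1]⟩
  have hχ : ∀ z : UnitAddCircle × UnitAddCircle, |K.χ z.1| ≤ ‖K.χ‖ * -Real.log ε := fun z => by
    have h := K.χ.norm_coe_le_norm z.1
    rw [Real.norm_eq_abs] at h
    nlinarith [norm_nonneg K.χ]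
  refine ⟨(Real.log δ - Real.log ε) ^ 2 + ‖K.χ‖ * -Real.log ε + K.quadConst * K.M * -Real.log ε,
    fun n => le_trans ?_ (le_sum_stayEvent (G := K.reach ε δ)
      (U := K.quadFun ε δ (-c₀) K.quadConst)
    measurable_pairStep (measurableSet_band ε δ) (fun z hz a => step_mem_reach hε hδR hz a)
    (fun z hz => (comb_step (log_mem_of_mem_band hε hz).1 (dist_lt_of_mem_band hδR hz) _ _ _ _ _).1)
    (fun z hz hzD => ?_) (by positivity) (fun z hz => ?_) (fun z hz => ?_) n hzr)⟩
  · rw [quadFun_eq]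
    have h1 := (abs_le.1 (quad_N_bounds (K := K) hε hεδ hδR hz)).1
    have h2 := (hQw z hzr).1
    have h3 := (abs_le.1 (hχ z)).2
    have h4 : 0 ≤ (K.b + ‖K.ψ‖) ^ 2 * -Real.log ε := by positivity
    rw [meanConst, hc₀]
    linarith
  · rw [quadFun_eq]
    have h1 := abs_le.1 (abs_N_sub_le (K := K) z)
    have h5 := (hQw z hz).2
    have h6 := (abs_le.1 (hχ z)).1
    set β := K.b + ‖K.ψ‖ with hβ
    have hβ0 : 0 ≤ β := by positivity
    have h7 : β * (Real.log δ - Real.log ε) ≤ β * -Real.log ε := by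
      gcongr
      linarith
    -- outside the band one of the two factors is at most `β`
    have h8 : (Real.log δ - K.N z) * (K.N z - Real.log ε) ≤ β * (Real.log δ - Real.log ε) := by
      obtain ⟨m, hm⟩ : ∃ m, m = K.N z - Real.log ε := ⟨_, rfl⟩
      obtain ⟨L, hL⟩ : ∃ L, L = Real.log δ - Real.log ε := ⟨_, rfl⟩
      have h9 : Real.log δ - K.N z = L - m := by rw [hm, hL]; ring
      have hL0 : 0 ≤ L := by linarith
      rw [h9, ← hm, ← hL]
      have hor : dist z.1 z.2 < ε ∨ δ < dist z.1 z.2 := by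
        by_contra! h
        exact hzD h
      rcases hor with h | h
      · have h10 : logDist z ≤ Real.log ε := Real.log_le_log hz.1 h.le
        have h11 : m ≤ β := by rw [hm, hβ]; linarith [h1.2]
        nlinarith [sq_nonneg m]
      · have h10 : Real.log δ ≤ logDist z := Real.log_le_log hδ h.le
        have h11 : L - m ≤ β := by rw [← h9, hβ]; linarith [h1.1]
        nlinarith [sq_nonneg (L - m)]
    rw [hc₀]
    linarith
  · rw [quadFun_eq]
    have h5 := (hQw z hz).2
    have h6 := (abs_le.1 (hχ z)).1
    have h7 : (Real.log δ - K.N z) * (K.N z - Real.log ε) ≤ (Real.log δ - Real.log ε) ^ 2 := by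
      nlinarith [sq_nonneg ((Real.log δ - K.N z) - (K.N z - Real.log ε)),
        sq_nonneg (Real.log δ - Real.log ε)]
    have h8 : 0 ≤ c₀ * -Real.log ε := mul_nonneg hc₀0 hl
    linarith
  · have h1 := (log_mem_of_mem_band hε hz).1
    have h2 := dist_lt_of_mem_band (K := K) hδR hz
    rw [quadFun, (comb_step h1 h2 _ _ _ _ _).2, comb]
    have h3 := (abs_le.1 (abs_quad_drift_le hε hεδ hδR hz)).1
    have h4 := mul_le_mul_of_nonneg_left (K.drift_w z h1 h2)
      (show 0 ≤ K.quadConst * -Real.log ε from mul_nonneg hQ hl)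
    linarith

end Corrector

/-! ### Exit times and exit events -/

theorem le_exitTime_iff {ε δ : ℝ} {x y : UnitAddCircle} {ω : ℕ → ℝ} {n : ℕ} :
    (n : ℕ∞) ≤ E.exitTime ε δ x y ω ↔ ω ∈ stayEvent E.pairStep (band ε δ) n (x, y) := by
  simp only [exitTime, exitBelow, exitAbove, le_min_iff, le_iInf_iff, stayEvent, Set.mem_ofPred_eq,
    walk_pairStep, band, Nat.cast_le]
  constructor
  · rintro ⟨h1, h2⟩ i hi
    exact ⟨not_lt.1 fun h => absurd (h1 i h) (by omega),
      not_lt.1 fun h => absurd (h2 i h) (by omega)⟩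
  · intro h
    exact ⟨fun i hi => not_lt.1 fun h' => absurd (h i h').1 (not_le.2 hi),
      fun i hi => not_lt.1 fun h' => absurd (h i h').2 (not_le.2 hi)⟩

theorem exitBelow_lt_iff {ε : ℝ} {x y : UnitAddCircle} {ω : ℕ → ℝ} {t : ℕ∞} :
    E.exitBelow ε x y ω < t ↔
      ∃ i : ℕ, ∃ _ : dist (E.iter ω i x) (E.iter ω i y) < ε, (i : ℕ∞) < t := by
  simp only [exitBelow, iInf_lt_iff]

theorem exitAbove_lt_iff {δ : ℝ} {x y : UnitAddCircle} {ω : ℕ → ℝ} {t : ℕ∞} :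
    E.exitAbove δ x y ω < t ↔
      ∃ i : ℕ, ∃ _ : δ < dist (E.iter ω i x) (E.iter ω i y), (i : ℕ∞) < t := by
  simp only [exitAbove, iInf_lt_iff]

theorem exists_mem_hitEvent_below {ε δ : ℝ} {x y : UnitAddCircle} {ω : ℕ → ℝ}
    (h : E.exitBelow ε x y ω < E.exitAbove δ x y ω) :
    ∃ n, ω ∈ hitEvent E.pairStep (band ε δ) {z | dist z.1 z.2 < ε} n (x, y) := by
  classical
  obtain ⟨i, hi, hlt⟩ := E.exitBelow_lt_iff.1 h
  have hex : ∃ i, dist (E.iter ω i x) (E.iter ω i y) < ε := ⟨i, hi⟩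
  refine ⟨Nat.find hex + 1, Nat.find hex, Nat.lt_succ_self _, ?_, fun j hj => ?_⟩
  · rw [walk_pairStep]
    exact Nat.find_spec hex
  · rw [walk_pairStep]
    refine ⟨not_lt.1 (Nat.find_min hex hj), not_lt.1 fun hδ => ?_⟩
    have h1 : E.exitAbove δ x y ω ≤ j := iInf₂_le j hδ
    have h2 : (i : ℕ∞) < j := hlt.trans_le h1
    have h3 : Nat.find hex ≤ i := Nat.find_min' hex hi
    exact absurd (by exact_mod_cast h2 : i < j) (by omega)

theorem exists_mem_hitEvent_above {ε δ : ℝ} {x y : UnitAddCircle} {ω : ℕ → ℝ}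
    (h : E.exitAbove δ x y ω < E.exitBelow ε x y ω) :
    ∃ n, ω ∈ hitEvent E.pairStep (band ε δ) {z | δ < dist z.1 z.2} n (x, y) := by
  classical
  obtain ⟨i, hi, hlt⟩ := E.exitAbove_lt_iff.1 h
  have hex : ∃ i, δ < dist (E.iter ω i x) (E.iter ω i y) := ⟨i, hi⟩
  refine ⟨Nat.find hex + 1, Nat.find hex, Nat.lt_succ_self _, ?_, fun j hj => ?_⟩
  · rw [walk_pairStep]
    exact Nat.find_spec hex
  · rw [walk_pairStep]
    refine ⟨not_lt.1 fun hε => ?_, not_lt.1 (Nat.find_min hex hj)⟩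
    have h1 : E.exitBelow ε x y ω ≤ j := iInf₂_le j hε
    have h2 : (i : ℕ∞) < j := hlt.trans_le h1
    have h3 : Nat.find hex ≤ i := Nat.find_min' hex hi
    exact absurd (by exact_mod_cast h2 : i < j) (by omega)

theorem exitBelow_ne_exitAbove {ε δ : ℝ} (hεδ : ε < δ) {x y : UnitAddCircle} {ω : ℕ → ℝ}
    (h : E.exitTime ε δ x y ω < ⊤) : E.exitBelow ε x y ω ≠ E.exitAbove δ x y ω := by
  intro heq
  rw [exitTime, ← heq, min_self] at h
  obtain ⟨n, hn⟩ := ENat.ne_top_iff_exists.1 h.ne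
  have hb : ∃ i, ∃ _ : dist (E.iter ω i x) (E.iter ω i y) < ε, (i : ℕ∞) < n + 1 := by
    refine E.exitBelow_lt_iff.1 ?_
    rw [← hn]
    exact_mod_cast Nat.lt_succ_self n
  have ha : ∃ i, ∃ _ : δ < dist (E.iter ω i x) (E.iter ω i y), (i : ℕ∞) < n + 1 := by
    refine E.exitAbove_lt_iff.1 ?_
    rw [← heq, ← hn]
    exact_mod_cast Nat.lt_succ_self n
  obtain ⟨i, hi, hin⟩ := hb
  obtain ⟨j, hj, hjn⟩ := ha
  have hi' : (n : ℕ∞) ≤ i := by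
    rw [hn]
    exact iInf₂_le i hi
  have hj' : (n : ℕ∞) ≤ j := by
    rw [hn, heq]
    exact iInf₂_le j hj
  have e1 : i = n := by
    have h1 : i < n + 1 := by exact_mod_cast hin
    have h2 : n ≤ i := by exact_mod_cast hi'
    omega
  have e2 : j = n := by
    have h1 : j < n + 1 := by exact_mod_cast hjn
    have h2 : n ≤ j := by exact_mod_cast hj'
    omega
  subst e1
  rw [e2] at hj
  linarith

theorem measureReal_le_of_exists_mem_hitEvent {A : Set (ℕ → ℝ)}
    {D B : Set (UnitAddCircle × UnitAddCircle)}
    {z : UnitAddCircle × UnitAddCircle} (hA : ∀ ω ∈ A, ∃ n, ω ∈ hitEvent E.pairStep D B n z) {c : ℝ}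
    (hc : ∀ n, E.ℙ.real (hitEvent E.pairStep D B n z) ≤ c) : E.ℙ.real A ≤ c := by
  have hmono : Monotone fun n => hitEvent E.pairStep D B n z := by
    rintro m n hmn ω ⟨i, hi, h⟩
    exact ⟨i, hi.trans_le hmn, h⟩
  have hsub : A ⊆ ⋃ n, hitEvent E.pairStep D B n z := fun ω hω => Set.mem_iUnion.2 (hA ω hω)
  refine (measureReal_mono hsub).trans ?_
  have h1 := tendsto_measure_iUnion_atTop (μ := E.ℙ) hmono
  have h2 : Tendsto (fun n => E.ℙ.real (hitEvent E.pairStep D B n z)) atTop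
      (𝓝 (E.ℙ.real (⋃ n, hitEvent E.pairStep D B n z))) :=
    (ENNReal.tendsto_toReal (measure_ne_top _ _)).comp h1
  exact le_of_tendsto' h2 hc

theorem toENNReal_eq_tsum (t : ℕ∞) :
    (t : ENNReal) = ∑' n : ℕ, if ((n + 1 : ℕ) : ℕ∞) ≤ t then 1 else 0 := by
  induction t using ENat.recTopCoe with
  | top => simp
  | coe k =>
    rw [tsum_eq_sum (s := Finset.range k)]
    · rw [Finset.sum_congr rfl (g := fun _ => (1 : ENNReal))]
      · simp
      · intro n hn
        rw [if_pos]
        exact_mod_cast Finset.mem_range.1 hn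
    · intro n hn
      rw [if_neg]
      intro h
      exact hn (Finset.mem_range.2 (by exact_mod_cast h))

theorem meanExitTime_eq_tsum (ε δ : ℝ) (x y : UnitAddCircle) :
    E.meanExitTime ε δ x y =
      ∑' n : ℕ, E.ℙ (stayEvent E.pairStep (band ε δ) (n + 1) (x, y)) := by
  classical
  have hm : ∀ n, MeasurableSet (stayEvent E.pairStep (band ε δ) n (x, y)) := fun n =>
    measurableSet_stayEvent E.continuous_pairStep.measurable (measurableSet_band ε δ) n (x, y)
  have h : ∀ ω, (E.exitTime ε δ x y ω : ENNReal) =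
      ∑' n : ℕ, (stayEvent E.pairStep (band ε δ) (n + 1) (x, y)).indicator 1 ω := by
    intro ω
    rw [toENNReal_eq_tsum]
    refine tsum_congr fun n => ?_
    rw [Set.indicator_apply]
    exact if_congr E.le_exitTime_iff rfl rfl
  rw [meanExitTime]
  simp only [h]
  rw [lintegral_tsum fun n => (measurable_one.indicator (hm (n + 1))).aemeasurable]
  exact tsum_congr fun n => lintegral_indicator_one (hm (n + 1))

/-- Summation of the bounds for the truncated mean exit times. -/
theorem Corrector.exit_mean {E : RandomCircleMap} (K : E.Corrector) (hV : 0 < E.V)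
    {ε δ : ℝ} (hε : 0 < ε)
    (hεδ : ε < δ) (hδR : δ < Real.exp (-K.b) * K.R) {x y : UnitAddCircle}
    (hz : (x, y) ∈ band ε δ) :
    (∀ᵐ ω ∂E.ℙ, E.exitTime ε δ x y ω < ⊤) ∧ E.meanExitTime ε δ x y ≠ ⊤ ∧
    |E.V * (E.meanExitTime ε δ x y).toReal -
      (Real.log δ - logDist (x, y)) * (logDist (x, y) - Real.log ε)| ≤
        K.meanConst * -Real.log ε := by
  set v : ℕ → ℝ := fun n => E.ℙ.real (stayEvent E.pairStep (band ε δ) n (x, y)) with hv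
  have hv0 : ∀ n, 0 ≤ v n := fun n => measureReal_nonneg
  have hup := fun n => K.sum_stay_le hε hεδ hδR hz n
  have hle : ∀ n, ∑ j ∈ Finset.range n, v (j + 1) ≤
      ((Real.log δ - logDist (x, y)) * (logDist (x, y) - Real.log ε) +
        K.meanConst * -Real.log ε) / E.V := fun n => by
    rw [le_div_iff₀ hV, mul_comm]
    exact hup n
  have hsum : Summable fun n => v (n + 1) :=
    summable_of_sum_range_le (fun n => hv0 _) hle
  have hmean : E.meanExitTime ε δ x y = ENNReal.ofReal (∑' n, v (n + 1)) := by
    rw [meanExitTime_eq_tsum, ENNReal.ofReal_tsum_of_nonneg (fun n => hv0 _) hsum]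
    exact tsum_congr fun n => (ofReal_measureReal (measure_ne_top _ _)).symm
  have hv_lim : Tendsto v atTop (𝓝 0) := (tendsto_add_atTop_iff_nat 1).1 hsum.tendsto_atTop_zero
  refine ⟨?_, ?_, ?_⟩
  · have hsub : ∀ n, E.ℙ.real {ω | ¬E.exitTime ε δ x y ω < ⊤} ≤ v n := fun n => by
      refine measureReal_mono fun ω hω => ?_
      refine E.le_exitTime_iff.1 ?_
      have h : E.exitTime ε δ x y ω = ⊤ := not_lt_top_iff.1 hω
      rw [h]
      exact le_top
    have h0 : E.ℙ.real {ω | ¬E.exitTime ε δ x y ω < ⊤} ≤ 0 := ge_of_tendsto' hv_lim hsub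
    rw [ae_iff, ← measureReal_eq_zero_iff]
    exact le_antisymm h0 measureReal_nonneg
  · rw [hmean]
    exact ENNReal.ofReal_ne_top
  · rw [hmean, ENNReal.toReal_ofReal (tsum_nonneg fun n => hv0 _)]
    have h1 : ∑' n, v (n + 1) ≤ _ := Real.tsum_le_of_sum_range_le (fun n => hv0 _) hle
    rw [le_div_iff₀ hV, mul_comm] at h1
    obtain ⟨C, hC⟩ := K.exists_le_sum_stay hε hεδ hδR hz
    have h2 : Tendsto (fun n => E.V * ∑ j ∈ Finset.range n, v (j + 1) + C * v n) atTop
        (𝓝 (E.V * ∑' n, v (n + 1) + C * 0)) :=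
      (hsum.hasSum.tendsto_sum_nat.const_mul _).add (hv_lim.const_mul _)
    have h3 := ge_of_tendsto' h2 hC
    rw [abs_le]
    constructor <;> linarith

/-- Optional stopping bounds each of the two exit probabilities from above; since exit is almost sure,
the bound on leaving through `δ` is the lower bound on leaving through `ε`. -/
theorem Corrector.exit_prob {E : RandomCircleMap} (K : E.Corrector) (hV : 0 < E.V)
    {ε δ : ℝ} (hε : 0 < ε)
    (hεδ : ε < δ) (hδR : δ < Real.exp (-K.b) * K.R) {x y : UnitAddCircle}
    (hz : (x, y) ∈ band ε δ) :
    (Real.log δ - logDist (x, y) - (‖K.ψ‖ + K.hitConst)) / (Real.log δ - Real.log ε) ≤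
        E.ℙ.real {ω | E.exitBelow ε x y ω < E.exitAbove δ x y ω} ∧
      E.ℙ.real {ω | E.exitBelow ε x y ω < E.exitAbove δ x y ω} ≤
        (Real.log δ - logDist (x, y) + (‖K.ψ‖ + K.hitConst)) / (Real.log δ - Real.log ε) := by
  have hL : 0 < Real.log δ - Real.log ε := sub_pos.2 (Real.log_lt_log hε hεδ)
  have hbelow : E.ℙ.real {ω | E.exitBelow ε x y ω < E.exitAbove δ x y ω} ≤ _ :=
    E.measureReal_le_of_exists_mem_hitEvent (fun ω hω => E.exists_mem_hitEvent_below hω)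
      (measureReal_hit_below_le hε hεδ hδR hz)
  have habove : E.ℙ.real {ω | E.exitAbove δ x y ω < E.exitBelow ε x y ω} ≤ _ :=
    E.measureReal_le_of_exists_mem_hitEvent (fun ω hω => E.exists_mem_hitEvent_above hω)
      (measureReal_hit_above_le hε hεδ hδR hz)
  refine ⟨?_, hbelow⟩
  have hae := (K.exit_mean hV hε hεδ hδR hz).1
  have hone : E.ℙ.real ({ω | E.exitBelow ε x y ω < E.exitAbove δ x y ω} ∪
      {ω | E.exitAbove δ x y ω < E.exitBelow ε x y ω}) = 1 := by
    refine (measureReal_congr (eventuallyEq_univ.2 ?_)).trans probReal_univ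
    filter_upwards [hae] with ω hω
    exact lt_or_gt_of_ne (E.exitBelow_ne_exitAbove hεδ hω)
  have h1 := measureReal_union_le (μ := E.ℙ) {ω | E.exitBelow ε x y ω < E.exitAbove δ x y ω}
    {ω | E.exitAbove δ x y ω < E.exitBelow ε x y ω}
  rw [hone] at h1
  have h2 : (logDist (x, y) - Real.log ε + (‖K.ψ‖ + K.hitConst)) / (Real.log δ - Real.log ε) =
      1 - (Real.log δ - logDist (x, y) - (‖K.ψ‖ + K.hitConst)) / (Real.log δ - Real.log ε) := by
    field_simp
    ring
  rw [h2] at habove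
  linarith

end RandomCircleMap

end

theorem lemma3p1 (E : RandomCircleMap) (hmin : E.Minorising) (hper : E.HasAttractingPeriodicOrbit)
    (μ : Measure UnitAddCircle) [IsProbabilityMeasure μ] (hμ : E.IsStationary μ)
    (hlyap : E.lyapunov μ = 0) :
    (∀ (q : ℝ) (x : UnitAddCircle),
      Tendsto (E.momentRate q x) atTop (𝓝 (E.momentLyapunov q))) ∧
    ContDiffAt ℝ 2 E.momentLyapunov 0 ∧
    0 < E.V ∧
    ∃ R K : ℝ, 0 < R ∧ 0 < K ∧
      ∀ (x y : UnitAddCircle) (ε δ : ℝ), 0 < ε → ε < dist x y → dist x y < δ → δ < R →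
        (∀ᵐ ω ∂E.ℙ, E.exitTime ε δ x y ω < ⊤) ∧
        ((Real.log (δ / dist x y) - 2 * K) / Real.log (δ / ε) ≤
            E.ℙ.real {ω | E.exitBelow ε x y ω < E.exitAbove δ x y ω} ∧
          E.ℙ.real {ω | E.exitBelow ε x y ω < E.exitAbove δ x y ω} ≤
            (Real.log (δ / dist x y) + 2 * K) / Real.log (δ / ε)) ∧
        (E.meanExitTime ε δ x y ≠ ⊤ ∧
          1 / E.V * (Real.log (δ / dist x y) * Real.log (dist x y / ε)
              - 6 * K * |Real.log ε| - 2 * K ^ 2) ≤ (E.meanExitTime ε δ x y).toReal ∧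
          (E.meanExitTime ε δ x y).toReal ≤
            1 / E.V * (Real.log (δ / dist x y) * Real.log (dist x y / ε)
              + 6 * K * |Real.log ε| + 2 * K ^ 2)) := by
  obtain ⟨hC2, ψ, hψ, hVψ, -⟩ := hμ.momentLyapunov_expansion hmin hlyap
  have hV : 0 < E.V := by
    rw [← hVψ]
    exact hμ.mean_incrementVar_pos hmin hper hψ
  obtain ⟨C⟩ := hμ.nonempty_corrector hmin hper hlyap
  have hhit := C.hitConst_nonneg
  have hmean := C.meanConst_nonneg
  have hψ0 := norm_nonneg C.ψ
  refine ⟨fun q x => E.tendsto_momentRate hmin q x, hC2, hV, Real.exp (-C.b) * C.R,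
    ‖C.ψ‖ + C.hitConst + C.meanConst + 1, mul_pos (Real.exp_pos _) C.R_pos, by positivity, ?_⟩
  intro x y ε δ hε hεd hdδ hδR
  obtain ⟨K, hK⟩ : ∃ K, K = ‖C.ψ‖ + C.hitConst + C.meanConst + 1 := ⟨_, rfl⟩
  rw [← hK]
  have hd : 0 < dist x y := hε.trans hεd
  have hδ : 0 < δ := hd.trans hdδ
  have hεδ : ε < δ := hεd.trans hdδ
  have hz : (x, y) ∈ RandomCircleMap.band ε δ := ⟨hεd.le, hdδ.le⟩
  have hlogε : Real.log ε < -1 :=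
    (Real.log_lt_log hε hεδ).trans (RandomCircleMap.Corrector.log_lt_neg_one hδ hδR)
  have hL : 0 < Real.log δ - Real.log ε := sub_pos.2 (Real.log_lt_log hε hεδ)
  obtain ⟨hfin, hne, habs⟩ := C.exit_mean hV hε hεδ hδR hz
  obtain ⟨hp1, hp2⟩ := C.exit_prob hV hε hεδ hδR hz
  rw [show RandomCircleMap.logDist (x, y) = Real.log (dist x y) from rfl] at habs hp1 hp2
  rw [Real.log_div hδ.ne' hd.ne', Real.log_div hδ.ne' hε.ne', Real.log_div hd.ne' hε.ne',
    abs_of_neg (by linarith : Real.log ε < 0)]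
  have hm : C.meanConst * -Real.log ε ≤ 6 * K * -Real.log ε := by
    gcongr
    · linarith
    · linarith
  have hK2 : 0 ≤ 2 * K ^ 2 := by positivity
  refine ⟨hfin, ⟨le_trans ?_ hp1, hp2.trans ?_⟩, hne, ?_, ?_⟩
  · gcongr
    linarith
  · gcongr
    linarith
  · rw [one_div, inv_mul_le_iff₀ hV]
    linarith [(abs_le.1 habs).1]
  · rw [one_div, ← div_eq_inv_mul, le_div_iff₀ hV]
    linarith [(abs_le.1 habs).2]
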